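/- Let $\mathcal L(\mathbb Z^2)$ be the square lattice graph (vertex set $\mathbb Z^2$, two vertices adjacent when they are at distance $1$). A subgraph $G$ of $\mathcal L(\mathbb Z^2)$ is called a simple grid graph if it consists of exactly the vertices and edges of $\mathcal L(\mathbb Z^2)$ that lie on or interior to a simple closed loop (a cycle) $\alpha$ of $\mathcal L(\mathbb Z^2)$; $\mathrm{Area}(G)$ denotes its number of faces, i.e. the number of unit lattice squares all four sides of which are edges of $G$, and $\tau(G)$ denotes its number of spanning trees. Let $G$ be a simple grid graph, let $\{V_1,\dots,V_K\}$ be a partition of its vertex set, let $G_i$ be the subgraph of $G$ induced by $V_i$, and assume that each $G_i$ is a simple grid graph. Let $\mathcal C$ be the set of cut edges, i.e. the edges of $G$ joining vertices that belong to different sets $V_i$. Then $$|\mathcal C| = C_1-\sum_{i=1}^K \mathrm{Area}(G_i),\qquad C_1=\mathrm{Area}(G)+K-1 .$$ Moreover, with $\mathfrak b=\exp(4C/\pi)$, where $C=\sum_{n\ge 0}(-1)^n/(2n+1)^2$ is Catalan's constant, $$C_1-\frac{1}{\ln \mathfrak b}\,\ln\Big(\prod_{i=1}^K\tau(G_i)\Big)\;\le\;|\mathcal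 C|\;\le\; C_1-\frac{1}{\ln 4}\,\ln\Big(\prod_{i=1}^K\tau(G_i)\Big).$$ -/

import Mathlib

open scoped BigOperators

noncomputable section

/-- The regular square lattice: vertex set `ℤ × ℤ`, rook-adjacent edges. -/
def squareLattice : SimpleGraph (ℤ × ℤ) where
  Adj p q := |p.1 - q.1| + |p.2 - q.2| = 1
  symm := ⟨fun p q h => by rw [abs_sub_comm q.1, abs_sub_comm q.2]; exact h⟩
  loopless := ⟨fun p h => by simp at h⟩

/-- The lattice point `p`, as a point of the plane. -/
def latticePoint (p : ℤ × ℤ) : ℝ × ℝ := ((p.1 : ℝ), (p.2 : ℝ))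

/-- The closed polygonal curve in the plane traced by a closed walk in the lattice: the union of
the segments spanned by its edges. -/
def loopTrace {v : ℤ × ℤ} (α : squareLattice.Walk v v) : Set (ℝ × ℝ) :=
  {x | ∃ p q : ℤ × ℤ, s(p, q) ∈ α.edges ∧ x ∈ segment ℝ (latticePoint p) (latticePoint q)}

/-- The interior of a loop: the points off the loop whose connected component in the complement
of the loop is bounded. -/
def loopInterior {v : ℤ × ℤ} (α : squareLattice.Walk v v) : Set (ℝ × ℝ) :=
  {x | x ∉ loopTrace α ∧ Bornology.IsBounded (connectedComponentIn (loopTrace α)ᶜ x)}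

/-- The region on and interior to a loop. -/
def loopRegion {v : ℤ × ℤ} (α : squareLattice.Walk v v) : Set (ℝ × ℝ) :=
  loopTrace α ∪ loopInterior α

/-- A subgraph of the square lattice is a *simple grid graph* if its vertices and edges are exactly
the lattice vertices and lattice edges that lie on or interior to a simple closed loop (a cycle of
the lattice). An edge lies there if the whole segment between its endpoints does. -/
def IsSimpleGridGraph (G : squareLattice.Subgraph) : Prop :=
  ∃ (v : ℤ × ℤ) (α : squareLattice.Walk v v), α.IsCycle ∧
    (∀ p, p ∈ G.verts ↔ latticePoint p ∈ loopRegion α) ∧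
    (∀ p q, G.Adj p q ↔
      squareLattice.Adj p q ∧ segment ℝ (latticePoint p) (latticePoint q) ⊆ loopRegion α)

/-- The faces of `G`, each recorded by its bottom-left corner: the unit squares of the lattice all
four sides of which are edges of `G`. -/
def gridFaces (G : squareLattice.Subgraph) : Set (ℤ × ℤ) :=
  {p | G.Adj p (p.1 + 1, p.2) ∧ G.Adj (p.1 + 1, p.2) (p.1 + 1, p.2 + 1) ∧
    G.Adj (p.1, p.2 + 1) (p.1 + 1, p.2 + 1) ∧ G.Adj p (p.1, p.2 + 1)}

/-- The area of `G`: its number of faces. -/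
def gridArea (G : squareLattice.Subgraph) : ℕ := (gridFaces G).ncard

/-- The cut edges: the edges of `G` between vertices that belong to different districts. -/
def cutEdges (G : squareLattice.Subgraph) {K : ℕ} (V : Fin K → Set (ℤ × ℤ)) :
    Set (Sym2 (ℤ × ℤ)) :=
  {e | e ∈ G.edgeSet ∧ ∃ i j : Fin K, i ≠ j ∧ ∃ p ∈ V i, ∃ q ∈ V j, e = s(p, q)}

/-- The number of spanning trees of `G`, that is, of trees on the whole vertex set of `G` all of
whose edges are edges of `G`. -/
def numSpanningTrees (G : squareLattice.Subgraph) : ℕ :=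
  {T : SimpleGraph G.verts | T ≤ G.coe ∧ T.IsTree}.ncard

/-- Catalan's constant `1 - 1/9 + 1/25 - 1/49 + ⋯` (an absolutely convergent series). -/
def catalanC : ℝ := ∑' n : ℕ, (-1 : ℝ) ^ n / (2 * (n : ℝ) + 1) ^ 2

/-- The base `exp (4C/π) ≈ 3.2099`. -/
def bulkBase : ℝ := Real.exp (4 * catalanC / Real.pi)

end

/-!
The faces of a simply connected grid form a `ℤ`-basis of its lattice of integer flows. Hence Euler's
formula holds for `G` and for every district, and adding up vertices and edges gives the number of
cut edges.

By Cauchy–Binet, `τ(G) = det (M Mᵀ)` for the face-edge matrix `M`, and `M Mᵀ = 4 - A` where `A` is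
the adjacency matrix of the cells of `G`. In the expansion
`log det (4 - A) = n log 4 - ∑ tr (A ^ k) / (k 4 ^ k)` over the `n = Area(G)` cells, all traces are
nonnegative, so `log τ(G) ≤ n log 4`. Each trace is at most `n` times the number of closed walks of
length `k` on the whole lattice, and the resulting series sums to `log 4 - 4C/π`, so
`log τ(G) ≥ 4nC/π`.
-/

section CauchyBinet

open Finset Matrix

variable {m n R : Type*} [Fintype m] [DecidableEq m] [CommRing R]

theorem det_mul_eq_sum_prod_mul_det [Fintype n] (M : Matrix m n R) (N : Matrix n m R) :
    (M * N).det = ∑ f : m → n, (∏ i, M i (f i)) * (N.submatrix f id).det := by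
  classical
  have hrows : M * N = fun i => ∑ k, M i k • N k := by
    ext i j
    simp [Matrix.mul_apply]
  rw [hrows]
  refine ((detRowAlternating (R := R) (n := m)).toMultilinearMap.map_sum _).trans ?_
  exact sum_congr rfl fun f _ =>
    (detRowAlternating (R := R) (n := m)).toMultilinearMap.map_smul_univ
      (fun i => M i (f i)) (fun i => N (f i))

/-- The Cauchy–Binet formula; summing over all maps `m → n` counts every maximal minor
`(card m)!` times. -/
theorem factorial_mul_det_mul [Fintype n] (M : Matrix m n R) (N : Matrix n m R) :
    ((Fintype.card m).factorial : R) * (M * N).det =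
      ∑ f : m → n, (M.submatrix id f).det * (N.submatrix f id).det := by
  classical
  have permuted (σ : Equiv.Perm m) : (M * N).det =
      ∑ f : m → n, ((Equiv.Perm.sign σ : ℤ) : R) * (∏ i, M i (f (σ i))) *
        (N.submatrix f id).det := by
    rw [det_mul_eq_sum_prod_mul_det]
    refine (Fintype.sum_equiv (Equiv.arrowCongr σ.symm (Equiv.refl n)) _ _ fun f => ?_).symm
    have hσ : (N.submatrix (fun i => f (σ i)) id).det
        = ((Equiv.Perm.sign σ : ℤ) : R) * (N.submatrix f id).det :=
      det_permute σ (N.submatrix f id)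
    change _ = (∏ i, M i (f (σ i))) * (N.submatrix (fun i => f (σ i)) id).det
    rw [hσ]
    ring
  calc ((Fintype.card m).factorial : R) * (M * N).det
      = ∑ _σ : Equiv.Perm m, (M * N).det := by simp [Fintype.card_perm]
    _ = ∑ f : m → n, (M.submatrix id f).det * (N.submatrix f id).det := by
      rw [sum_congr rfl fun σ _ => permuted σ, sum_comm]
      refine sum_congr rfl fun f _ => ?_
      rw [← sum_mul, ← det_transpose (M.submatrix id f), det_apply' (M.submatrix id f)ᵀ]
      rfl

theorem det_submatrix_eq_zero_of_not_injective (M : Matrix m n R) {f : m → n}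
    (hf : ¬ Function.Injective f) : (M.submatrix id f).det = 0 := by
  simp only [Function.Injective, not_forall] at hf
  obtain ⟨i, j, hij, hne⟩ := hf
  exact det_zero_of_column_eq hne fun k => by simp [hij]

theorem card_filter_injective_image_eq [Fintype n] [DecidableEq n] {S : Finset n}
    (hS : #S = Fintype.card m) :
    #{f : m → n | Function.Injective f ∧ univ.image f = S} = (Fintype.card m).factorial := by
  have himage {f : m → n} (hf : Function.Injective f) :
      univ.image f = S ↔ ∀ i, f i ∈ S := by
    refine ⟨fun h i => h ▸ mem_image_of_mem f (mem_univ i), fun h => ?_⟩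
    refine eq_of_subset_of_card_le (by simpa [image_subset_iff] using h) ?_
    rw [card_image_of_injective _ hf, hS, card_univ]
  have hemb : Fintype.card (m ↪ S) = (Fintype.card m).factorial := by
    simp [Fintype.card_embedding_eq, hS, Nat.descFactorial_self]
  rw [← hemb, ← card_univ]
  refine (card_bij (fun g _ i => (g i : n)) (fun g _ => ?_) (fun g _ g' _ h => ?_)
    fun f hf => ?_).symm
  · have hg : Function.Injective fun i => (g i : n) := Subtype.val_injective.comp g.injective
    simp [hg, (himage hg).2]
  · ext i
    exact congrFun h i
  · obtain ⟨hinj, hfS⟩ := (mem_filter.1 hf).2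
    exact ⟨⟨fun i => ⟨f i, (himage hinj).1 hfS i⟩, fun i j h => hinj (congrArg Subtype.val h)⟩,
      mem_univ _, rfl⟩

theorem card_filter_injective_image_mem [Fintype n] [DecidableEq n] {𝒮 : Finset (Finset n)}
    (h𝒮 : ∀ S ∈ 𝒮, #S = Fintype.card m) :
    #{f : m → n | Function.Injective f ∧ univ.image f ∈ 𝒮} =
      (Fintype.card m).factorial * #𝒮 := by
  rw [card_eq_sum_card_fiberwise (f := fun f => univ.image f) (t := 𝒮)
    fun f hf => (mem_filter.1 hf).2.2, mul_comm, ← smul_eq_mul, ← sum_const]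
  refine sum_congr rfl fun S hS => ?_
  rw [← card_filter_injective_image_eq (h𝒮 S hS), filter_filter]
  congr 1
  ext f
  simp only [mem_filter, mem_univ, true_and]
  exact ⟨fun h => ⟨h.1.1, h.2⟩, fun h => ⟨⟨h.1, h.2 ▸ hS⟩, h.2⟩⟩

end CauchyBinet

section CycleBasis

open Finset Matrix

variable {V E F : Type*}

/-- The graph on `V` whose edges are `s e — t e` for `e ∈ S`; loops are discarded. -/
def edgeGraph (s t : E → V) (S : Set E) : SimpleGraph V :=
  SimpleGraph.fromEdgeSet ((fun e => s(s e, t e)) '' S)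

/-- The signed incidence matrix of the graph with edges `s e → t e`. An integer flow is a row
vector that it annihilates. -/
def signedIncidence [DecidableEq V] (s t : E → V) : Matrix E V ℤ :=
  Matrix.of fun e => Pi.single (t e) 1 - Pi.single (s e) 1

/-- The rows of `M` are a `ℤ`-basis of the lattice of integer flows. -/
structure IsCycleBasis [DecidableEq V] [Fintype E] [Fintype F] (s t : E → V)
    (M : Matrix F E ℤ) : Prop where
  mul_signedIncidence : M * signedIncidence s t = 0
  eq_zero_of_vecMul_eq_zero : ∀ c, c ᵥ* M = 0 → c = 0
  exists_vecMul_eq : ∀ z, z ᵥ* signedIncidence s t = 0 → ∃ c, c ᵥ* M = z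

variable {s t : E → V}

theorem exists_of_edgeGraph_adj {S : Set E} {u v : V} (h : (edgeGraph s t S).Adj u v) :
    ∃ e ∈ S, (s e = u ∧ t e = v) ∨ (s e = v ∧ t e = u) := by
  simp only [edgeGraph, SimpleGraph.fromEdgeSet_adj, Set.mem_image, Sym2.eq_iff] at h
  exact h.1

theorem edgeGraph_adj_of_mem (hne : ∀ e, s e ≠ t e) {S : Set E} {e : E} (he : e ∈ S) :
    (edgeGraph s t S).Adj (s e) (t e) :=
  (SimpleGraph.fromEdgeSet_adj _).2 ⟨⟨e, he, rfl⟩, hne e⟩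

theorem edgeGraph_reachable_of_mem {S : Set E} {e : E} (he : e ∈ S) :
    (edgeGraph s t S).Reachable (s e) (t e) := by
  by_cases h : s e = t e
  · rw [h]
  · exact ((SimpleGraph.fromEdgeSet_adj _).2 ⟨⟨e, he, rfl⟩, h⟩ :
      (edgeGraph s t S).Adj (s e) (t e)).reachable

theorem edgeGraph_mono {S S' : Set E} (h : S ⊆ S') : edgeGraph s t S ≤ edgeGraph s t S' :=
  SimpleGraph.fromEdgeSet_mono (Set.image_mono h)

theorem edgeSet_edgeGraph (hne : ∀ e, s e ≠ t e) (S : Set E) :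
    (edgeGraph s t S).edgeSet = (fun e => s(s e, t e)) '' S := by
  rw [edgeGraph, SimpleGraph.edgeSet_fromEdgeSet, sdiff_eq_left, Set.disjoint_left]
  rintro _ ⟨e, -, rfl⟩ h
  exact hne e (by simpa using h)

theorem natCard_edgeSet_edgeGraph (hinj : Function.Injective fun e => s(s e, t e))
    (hne : ∀ e, s e ≠ t e) (S : Set E) : Nat.card (edgeGraph s t S).edgeSet = S.ncard := by
  rw [edgeSet_edgeGraph hne, Nat.card_coe_set_eq, Set.ncard_image_of_injective _ hinj]

theorem edgeGraph_injective (hinj : Function.Injective fun e => s(s e, t e))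
    (hne : ∀ e, s e ≠ t e) : Function.Injective (edgeGraph s t) := by
  intro S S' h
  have hedges := congrArg SimpleGraph.edgeSet h
  rw [edgeSet_edgeGraph hne, edgeSet_edgeGraph hne] at hedges
  exact Set.image_injective.2 hinj hedges

theorem exists_edgeGraph_eq_of_le (hne : ∀ e, s e ≠ t e) {T : SimpleGraph V}
    (hT : T ≤ edgeGraph s t Set.univ) : ∃ S, edgeGraph s t S = T := by
  refine ⟨{e | T.Adj (s e) (t e)}, le_antisymm (fun u v h => ?_) fun u v h => ?_⟩
  · obtain ⟨e, he, ⟨rfl, rfl⟩ | ⟨rfl, rfl⟩⟩ := exists_of_edgeGraph_adj h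
    exacts [he, he.symm]
  · obtain ⟨e, -, ⟨rfl, rfl⟩ | ⟨rfl, rfl⟩⟩ := exists_of_edgeGraph_adj (hT h)
    exacts [edgeGraph_adj_of_mem hne h, (edgeGraph_adj_of_mem hne h.symm).symm]

theorem eq_of_edgeGraph_reachable {X : Type*} {S : Set E} {φ : V → X}
    (hφ : ∀ e ∈ S, φ (s e) = φ (t e)) {u v : V} (h : (edgeGraph s t S).Reachable u v) :
    φ u = φ v := by
  obtain ⟨p⟩ := h
  induction p with
  | nil => rfl
  | cons h p ih =>
    rw [← ih]
    obtain ⟨e, he, ⟨rfl, rfl⟩ | ⟨rfl, rfl⟩⟩ := exists_of_edgeGraph_adj h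
    exacts [hφ e he, (hφ e he).symm]

theorem ncard_spanningTrees_eq_card_cotrees [Fintype E]
    (hinj : Function.Injective fun e => s(s e, t e))
    (hne : ∀ e, s e ≠ t e)
    [DecidablePred fun S : Finset E => (edgeGraph s t (S : Set E)ᶜ).IsTree] :
    {T : SimpleGraph V | T ≤ edgeGraph s t Set.univ ∧ T.IsTree}.ncard =
      #{S : Finset E | (edgeGraph s t (S : Set E)ᶜ).IsTree} := by
  classical
  rw [← Set.ncard_coe_finset, ← Set.ncard_image_of_injective (f := fun S : Finset E =>
    edgeGraph s t (S : Set E)ᶜ) _ fun S S' h =>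
      coe_injective (compl_injective (edgeGraph_injective hinj hne h))]
  congr 1
  ext T
  simp only [Set.mem_ofPred_eq, Set.mem_image, mem_coe, mem_filter, mem_univ, true_and]
  constructor
  · rintro ⟨hle, hT⟩
    obtain ⟨S, rfl⟩ := exists_edgeGraph_eq_of_le hne hle
    exact ⟨Sᶜ.toFinset, by simpa using hT, by simp⟩
  · rintro ⟨S, hS, rfl⟩
    exact ⟨edgeGraph_mono (Set.subset_univ _), hS⟩

variable [DecidableEq V]

theorem signedIncidence_mulVec [Fintype V] (φ : V → ℤ) (e : E) :
    (signedIncidence s t *ᵥ φ) e = φ (t e) - φ (s e) := by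
  change (Pi.single (t e) 1 - Pi.single (s e) 1) ⬝ᵥ φ = _
  simp [sub_dotProduct]

variable [Fintype E]

theorem exists_unit_flow {S : Set E} {u v : V} (h : (edgeGraph s t S).Reachable u v) :
    ∃ z : E → ℤ, (∀ e ∉ S, z e = 0) ∧
      z ᵥ* signedIncidence s t = Pi.single v 1 - Pi.single u 1 := by
  classical
  obtain ⟨p⟩ := h
  induction p with
  | nil => exact ⟨0, by simp, by simp⟩
  | @cons u v x h p ih =>
    obtain ⟨z, hzS, hz⟩ := ih
    obtain ⟨e, he, hends⟩ := exists_of_edgeGraph_adj h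
    have hsingle (a : ℤ) : ∀ e' ∉ S, (z + Pi.single e a : E → ℤ) e' = 0 := fun e' he' => by
      simp [hzS e' he', ne_of_mem_of_not_mem he he']
    rcases hends with ⟨rfl, rfl⟩ | ⟨rfl, rfl⟩
    · refine ⟨z + Pi.single e 1, hsingle 1, ?_⟩
      rw [add_vecMul, hz, single_one_vecMul]
      simp [signedIncidence]
    · refine ⟨z + Pi.single e (-1), hsingle (-1), ?_⟩
      rw [add_vecMul, hz, Pi.single_neg, neg_vecMul, single_one_vecMul]
      simp [signedIncidence]

namespace IsCycleBasis

variable [Fintype F] {M : Matrix F E ℤ}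

theorem vecMul_vecMul (hM : IsCycleBasis s t M) (c : F → ℤ) :
    c ᵥ* M ᵥ* signedIncidence s t = 0 := by
  rw [Matrix.vecMul_vecMul, hM.mul_signedIncidence, vecMul_zero]

/-- The left inverse consists of the fundamental cycles of the edges `f i`, closed up outside the
range of `f`. -/
theorem exists_mul_submatrix_eq_one (hM : IsCycleBasis s t M) {I : Type*} [DecidableEq I]
    {f : I → E} (hf : Function.Injective f)
    (hconn : (edgeGraph s t (Set.range f)ᶜ).Connected) :
    ∃ C : Matrix I F ℤ, C * M.submatrix id f = 1 := by
  classical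
  have cycle (i : I) : ∃ c : F → ℤ, ∀ j, (c ᵥ* M) (f j) = if i = j then 1 else 0 := by
    obtain ⟨z, hz, hflow⟩ := exists_unit_flow (hconn.preconnected (t (f i)) (s (f i)))
    obtain ⟨c, hc⟩ := hM.exists_vecMul_eq (z + Pi.single (f i) 1) <| by
      rw [add_vecMul, hflow, single_one_vecMul]
      simp [signedIncidence]
    refine ⟨c, fun j => ?_⟩
    rw [hc]
    simp [hz (f j) (by simp), Pi.single_apply, hf.eq_iff, eq_comm]
  choose C hC using cycle
  refine ⟨Matrix.of C, ?_⟩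
  ext i j
  rw [one_apply, ← hC i j]
  rfl

theorem card_le_of_connected (hM : IsCycleBasis s t M) {I : Type*} [Fintype I] {f : I → E}
    (hf : Function.Injective f) (hconn : (edgeGraph s t (Set.range f)ᶜ).Connected) :
    Fintype.card I ≤ Fintype.card F := by
  classical
  obtain ⟨C, hC⟩ := hM.exists_mul_submatrix_eq_one hf hconn
  have hinj : Function.Injective (mulVecLin (M.submatrix id f)) :=
    Function.LeftInverse.injective (g := mulVecLin C) fun x => by simp [mulVec_mulVec, hC]
  simpa using LinearMap.finrank_le_finrank_of_injective hinj

theorem det_submatrix_mul_self_of_connected [DecidableEq F] (hM : IsCycleBasis s t M)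
    {f : F → E} (hf : Function.Injective f)
    (hconn : (edgeGraph s t (Set.range f)ᶜ).Connected) :
    (M.submatrix id f).det * (M.submatrix id f).det = 1 := by
  obtain ⟨C, hC⟩ := hM.exists_mul_submatrix_eq_one hf hconn
  have hdet := congrArg Matrix.det hC
  rw [det_mul, det_one] at hdet
  exact Int.isUnit_mul_self (IsUnit.of_mul_eq_one_right _ hdet)

section Euler

variable [Fintype V]

/-- Flows and potential differences are orthogonal. -/
theorem eq_zero_of_vecMul_add_mulVec_eq_zero (hM : IsCycleBasis s t M) {c : F → ℤ} {φ : V → ℤ}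
    (h : c ᵥ* M + signedIncidence s t *ᵥ φ = 0) :
    c = 0 ∧ signedIncidence s t *ᵥ φ = 0 := by
  have horth : (c ᵥ* M) ⬝ᵥ (signedIncidence s t *ᵥ φ) = 0 := by
    rw [dotProduct_mulVec, hM.vecMul_vecMul, zero_dotProduct]
  have hself : (c ᵥ* M) ⬝ᵥ (c ᵥ* M) = 0 := by
    simpa [dotProduct_add, horth] using congrArg ((c ᵥ* M) ⬝ᵥ ·) h
  have hc : c ᵥ* M = 0 := dotProduct_self_eq_zero.1 hself
  exact ⟨hM.eq_zero_of_vecMul_eq_zero c hc, by simpa [hc] using h⟩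

theorem card_add_card_le (hM : IsCycleBasis s t M)
    (hconn : (edgeGraph s t Set.univ).Connected) :
    Fintype.card F + Fintype.card V ≤ Fintype.card E + 1 := by
  obtain ⟨v₀⟩ := hconn.nonempty
  let L : ((F → ℤ) × (V → ℤ)) →ₗ[ℤ] (E → ℤ) × ℤ :=
    (M.vecMulLinear.coprod (signedIncidence s t).mulVecLin).prod
      (LinearMap.proj v₀ ∘ₗ LinearMap.snd ℤ _ _)
  have hL : Function.Injective L := by
    rw [← LinearMap.ker_eq_bot, LinearMap.ker_eq_bot']
    rintro ⟨c, φ⟩ h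
    obtain ⟨hc, hφ⟩ := hM.eq_zero_of_vecMul_add_mulVec_eq_zero (congrArg Prod.fst h)
    have hφ₀ : φ v₀ = 0 := congrArg Prod.snd h
    have hconst (v : V) : φ v = φ v₀ := by
      refine eq_of_edgeGraph_reachable (fun e _ => ?_) (hconn.preconnected v v₀)
      have := congrFun hφ e
      rw [signedIncidence_mulVec] at this
      exact (sub_eq_zero.1 this).symm
    exact Prod.ext hc (funext fun v => (hconst v).trans hφ₀)
  simpa using LinearMap.finrank_le_finrank_of_injective hL

theorem card_add_card_eq (hM : IsCycleBasis s t M)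
    (hinj : Function.Injective fun e => s(s e, t e)) (hne : ∀ e, s e ≠ t e)
    (hconn : (edgeGraph s t Set.univ).Connected) :
    Fintype.card F + Fintype.card V = Fintype.card E + 1 := by
  refine le_antisymm (hM.card_add_card_le hconn) ?_
  obtain ⟨T, hT, htree⟩ := hconn.exists_isTree_le
  obtain ⟨S, rfl⟩ := exists_edgeGraph_eq_of_le hne hT
  have htreeCard := (SimpleGraph.isTree_iff_connected_and_card.1 htree).2
  rw [natCard_edgeSet_edgeGraph hinj hne, Nat.card_eq_fintype_card] at htreeCard
  have hcompl := Set.toFinite Sᶜ |>.fintype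
  have hle := hM.card_le_of_connected (I := (Sᶜ : Set E)) (f := Subtype.val)
    Subtype.val_injective (by rw [Subtype.range_coe, compl_compl]; exact htree.connected)
  rw [← Nat.card_eq_fintype_card, Nat.card_coe_set_eq] at hle
  have hsplit := Set.ncard_add_ncard_compl S
  rw [Nat.card_eq_fintype_card] at hsplit
  omega

end Euler

variable [Finite V]

theorem edgeGraph_compl_isTree_iff (hM : IsCycleBasis s t M)
    (hinj : Function.Injective fun e => s(s e, t e)) (hne : ∀ e, s e ≠ t e)
    (hconn : (edgeGraph s t Set.univ).Connected) (S : Set E) :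
    (edgeGraph s t Sᶜ).IsTree ↔ (edgeGraph s t Sᶜ).Connected ∧ S.ncard = Fintype.card F := by
  have := Fintype.ofFinite V
  have heuler := hM.card_add_card_eq hinj hne hconn
  have hsplit := Set.ncard_add_ncard_compl S
  rw [SimpleGraph.isTree_iff_connected_and_card, natCard_edgeSet_edgeGraph hinj hne]
  rw [Nat.card_eq_fintype_card] at hsplit ⊢
  exact and_congr_right fun _ => by omega

variable [DecidableEq F]

/-- The kernel vector is the coboundary of the indicator `φ` of a component of the graph outside
the range of `f`. -/
theorem det_submatrix_of_not_connected (hM : IsCycleBasis s t M)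
    (hconn : (edgeGraph s t Set.univ).Connected) {f : F → E} (hf : Function.Injective f)
    (hdisc : ¬ (edgeGraph s t (Set.range f)ᶜ).Connected) : (M.submatrix id f).det = 0 := by
  classical
  have := Fintype.ofFinite V
  have hV := hconn.nonempty
  rw [SimpleGraph.connected_iff, and_iff_left hV, SimpleGraph.Preconnected] at hdisc
  push Not at hdisc
  obtain ⟨u, v, huv⟩ := hdisc
  let φ : V → ℤ := fun w => if (edgeGraph s t (Set.range f)ᶜ).Reachable u w then 1 else 0
  have hφ : ∀ e ∉ Set.range f, φ (s e) = φ (t e) := by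
    intro e he
    have hst := edgeGraph_reachable_of_mem (s := s) (t := t) (S := (Set.range f)ᶜ) he
    have hiff : (edgeGraph s t (Set.range f)ᶜ).Reachable u (s e) ↔
      (edgeGraph s t (Set.range f)ᶜ).Reachable u (t e) :=
      ⟨fun h => h.trans hst, fun h => h.trans hst.symm⟩
    simp only [φ, hiff]
  rw [← exists_mulVec_eq_zero_iff]
  refine ⟨(signedIncidence s t *ᵥ φ) ∘ f, fun hcut => ?_, ?_⟩
  · have hφuv : φ u = φ v := by
      refine eq_of_edgeGraph_reachable (fun e _ => ?_) (hconn.preconnected u v)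
      by_cases he : e ∈ Set.range f
      · obtain ⟨i, rfl⟩ := he
        have hi := congrFun hcut i
        rw [Function.comp_apply, signedIncidence_mulVec] at hi
        exact (sub_eq_zero.1 hi).symm
      · exact hφ e he
    simp [φ, huv] at hφuv
  · have horth : M *ᵥ (signedIncidence s t *ᵥ φ) = 0 := by
      rw [mulVec_mulVec, hM.mul_signedIncidence, zero_mulVec]
    rw [← horth]
    funext i
    refine Fintype.sum_of_injective f hf _ _ (fun e he => ?_) fun _ => rfl
    rw [signedIncidence_mulVec, hφ e he, sub_self, mul_zero]

theorem det_submatrix_mul_self (hM : IsCycleBasis s t M)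
    (hinj : Function.Injective fun e => s(s e, t e)) (hne : ∀ e, s e ≠ t e)
    (hconn : (edgeGraph s t Set.univ).Connected) (f : F → E)
    [Decidable (Function.Injective f ∧ (edgeGraph s t (Set.range f)ᶜ).IsTree)] :
    (M.submatrix id f).det * (M.submatrix id f).det =
      if Function.Injective f ∧ (edgeGraph s t (Set.range f)ᶜ).IsTree then 1 else 0 := by
  by_cases hf : Function.Injective f
  · have hcard : (Set.range f).ncard = Fintype.card F := by
      rw [Set.ncard_range_of_injective hf, Nat.card_eq_fintype_card]
    have htree := hM.edgeGraph_compl_isTree_iff hinj hne hconn (Set.range f)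
    rw [and_iff_left hcard] at htree
    split_ifs with h
    · exact hM.det_submatrix_mul_self_of_connected hf (htree.1 h.2)
    · rw [hM.det_submatrix_of_not_connected hconn hf fun hc => h ⟨hf, htree.2 hc⟩, mul_zero]
  · rw [if_neg fun h => hf h.1, det_submatrix_eq_zero_of_not_injective M hf, mul_zero]

/-- The matrix-tree theorem in its dual form: in the Cauchy–Binet expansion of `det (M Mᵀ)` the
nonzero minors are `±1` and belong to the complements of spanning trees. -/
theorem ncard_spanningTrees_eq_det (hM : IsCycleBasis s t M)
    (hinj : Function.Injective fun e => s(s e, t e)) (hne : ∀ e, s e ≠ t e)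
    (hconn : (edgeGraph s t Set.univ).Connected) :
    ({T : SimpleGraph V | T ≤ edgeGraph s t Set.univ ∧ T.IsTree}.ncard : ℤ) =
      (M * Mᵀ).det := by
  classical
  set 𝒮 : Finset (Finset E) := {S | (edgeGraph s t (S : Set E)ᶜ).IsTree} with h𝒮
  have hcard : ∀ S ∈ 𝒮, #S = Fintype.card F := fun S hS => by
    rw [← Set.ncard_coe_finset]
    exact ((hM.edgeGraph_compl_isTree_iff hinj hne hconn S).1 (mem_filter.1 hS).2).2
  have hminor (f : F → E) : (M.submatrix id f).det * (Mᵀ.submatrix f id).det =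
      if Function.Injective f ∧ univ.image f ∈ 𝒮 then 1 else 0 := by
    rw [← transpose_submatrix, det_transpose, hM.det_submatrix_mul_self hinj hne hconn]
    simp [h𝒮]
  have hbinet := factorial_mul_det_mul M Mᵀ
  simp only [hminor, sum_boole, card_filter_injective_image_mem hcard] at hbinet
  rw [ncard_spanningTrees_eq_card_cotrees hinj hne]
  push_cast at hbinet
  exact (mul_left_cancel₀ (by exact_mod_cast Nat.factorial_ne_zero _) hbinet).symm

end IsCycleBasis

end CycleBasis

section LatticeChains

open Set

theorem squareLattice_adj_iff (p q : ℤ × ℤ) : squareLattice.Adj p q ↔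
    q = (p.1 + 1, p.2) ∨ p = (q.1 + 1, q.2) ∨ q = (p.1, p.2 + 1) ∨ p = (q.1, q.2 + 1) := by
  obtain ⟨a, b⟩ := p
  obtain ⟨c, d⟩ := q
  simp only [squareLattice, Prod.mk.injEq]
  rcases abs_cases (a - c) with ⟨h1, h1'⟩ | ⟨h1, h1'⟩ <;>
    rcases abs_cases (b - d) with ⟨h2, h2'⟩ | ⟨h2, h2'⟩ <;> rw [h1, h2] <;> omega

theorem squareLattice_adj_right (a b : ℤ) : squareLattice.Adj (a, b) (a + 1, b) :=
  (squareLattice_adj_iff _ _).2 (Or.inl rfl)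

theorem squareLattice_adj_up (a b : ℤ) : squareLattice.Adj (a, b) (a, b + 1) :=
  (squareLattice_adj_iff _ _).2 (Or.inr (Or.inr (Or.inl rfl)))

/-- The four lattice points adjacent to `p`. -/
def latticeNeighbors (p : ℤ × ℤ) : Finset (ℤ × ℤ) :=
  {(p.1 + 1, p.2), (p.1 - 1, p.2), (p.1, p.2 + 1), (p.1, p.2 - 1)}

theorem mem_latticeNeighbors {p q : ℤ × ℤ} : q ∈ latticeNeighbors p ↔ squareLattice.Adj p q := by
  simp only [latticeNeighbors, Finset.mem_insert, Finset.mem_singleton, squareLattice_adj_iff,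
    Prod.ext_iff]
  omega

theorem sum_latticeNeighbors {R : Type*} [AddCommMonoid R] (c : ℤ × ℤ → R) (p : ℤ × ℤ) :
    ∑ q ∈ latticeNeighbors p, c q =
      c (p.1 + 1, p.2) + c (p.1 - 1, p.2) + c (p.1, p.2 + 1) + c (p.1, p.2 - 1) := by
  rw [latticeNeighbors, Finset.sum_insert, Finset.sum_insert, Finset.sum_insert,
    Finset.sum_singleton, ← add_assoc, ← add_assoc] <;>
  · simp only [Finset.mem_insert, Finset.mem_singleton, Prod.mk.injEq]
    omega

/-- The edges of the square lattice, oriented rightwards and upwards: `(p, false)` starts at `p` and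
points to the right, `(p, true)` starts at `p` and points upwards. -/
abbrev LatticeEdge := (ℤ × ℤ) × Bool

/-- The endpoint of an oriented lattice edge; its starting point is the first component. -/
def edgeHead : LatticeEdge → ℤ × ℤ
  | (p, false) => (p.1 + 1, p.2)
  | (p, true) => (p.1, p.2 + 1)

theorem ne_edgeHead (e : LatticeEdge) : e.1 ≠ edgeHead e := by
  obtain ⟨⟨x, y⟩, _ | _⟩ := e <;> simp [edgeHead]

theorem injective_mk_edgeHead : Function.Injective fun e : LatticeEdge => s(e.1, edgeHead e) := by
  rintro ⟨⟨x, y⟩, _ | _⟩ ⟨⟨x', y'⟩, _ | _⟩ h <;>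
    simp only [edgeHead, Sym2.eq_iff, Prod.mk.injEq, and_true,
      reduceCtorEq, and_false] at h ⊢ <;> omega

theorem exists_latticeEdge_of_adj {p q : ℤ × ℤ} (h : squareLattice.Adj p q) :
    ∃ e : LatticeEdge, (e.1 = p ∧ edgeHead e = q) ∨ (e.1 = q ∧ edgeHead e = p) := by
  rcases (squareLattice_adj_iff p q).1 h with h | h | h | h
  · exact ⟨(p, false), Or.inl ⟨rfl, h.symm⟩⟩
  · exact ⟨(q, false), Or.inr ⟨rfl, h.symm⟩⟩
  · exact ⟨(p, true), Or.inl ⟨rfl, h.symm⟩⟩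
  · exact ⟨(q, true), Or.inr ⟨rfl, h.symm⟩⟩

theorem edgeHead_eq_iff {e : LatticeEdge} {p : ℤ × ℤ} : edgeHead e = p ↔
    e ∈ ({((p.1 - 1, p.2), false), ((p.1, p.2 - 1), true)} : Finset LatticeEdge) := by
  obtain ⟨⟨a, b⟩, _ | _⟩ := e <;>
    simp only [edgeHead, Finset.mem_insert, Finset.mem_singleton, Prod.ext_iff, reduceCtorEq,
      and_true, and_false, or_false, false_or] <;> omega

theorem edgeTail_eq_iff {e : LatticeEdge} {p : ℤ × ℤ} : e.1 = p ↔
    e ∈ ({(p, false), (p, true)} : Finset LatticeEdge) := by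
  obtain ⟨p', _ | _⟩ := e <;> simp

/-- The cellular boundary of a chain of unit squares, oriented counterclockwise and recorded by
their bottom-left corners. -/
def latticeBoundary (c : ℤ × ℤ → ℤ) : LatticeEdge → ℤ
  | (p, false) => c p - c (p.1, p.2 - 1)
  | (p, true) => c (p.1 - 1, p.2) - c p

/-- The cellular boundary of a chain of edges: the net flow into the lattice point `p`. -/
def latticeInflow (w : LatticeEdge → ℤ) (p : ℤ × ℤ) : ℤ :=
  w ((p.1 - 1, p.2), false) + w ((p.1, p.2 - 1), true) - (w (p, false) + w (p, true))

/-- The circulation of `w` around the unit square with bottom-left corner `f`. -/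
def latticeCurl (w : LatticeEdge → ℤ) (f : ℤ × ℤ) : ℤ :=
  w (f, false) + w ((f.1 + 1, f.2), true) - (w ((f.1, f.2 + 1), false) + w (f, true))

theorem latticeInflow_latticeBoundary (c : ℤ × ℤ → ℤ) (p : ℤ × ℤ) :
    latticeInflow (latticeBoundary c) p = 0 := by
  simp only [latticeInflow, latticeBoundary]
  ring

theorem latticeCurl_latticeBoundary (c : ℤ × ℤ → ℤ) (p : ℤ × ℤ) :
    latticeCurl (latticeBoundary c) p = 4 * c p - ∑ q ∈ latticeNeighbors p, c q := by
  simp only [latticeCurl, latticeBoundary, sum_latticeNeighbors, add_sub_cancel_right]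
  ring

theorem latticeBoundary_single (f : ℤ × ℤ) (e : LatticeEdge) :
    latticeBoundary (Pi.single f 1) e =
      (if e ∈ ({(f, false), ((f.1 + 1, f.2), true)} : Finset LatticeEdge) then 1 else 0) -
        if e ∈ ({((f.1, f.2 + 1), false), (f, true)} : Finset LatticeEdge) then 1 else 0 := by
  obtain ⟨⟨x, y⟩, _ | _⟩ := e <;>
    simp only [latticeBoundary, Pi.single_apply, Finset.mem_insert, Finset.mem_singleton,
      Prod.ext_iff, reduceCtorEq, and_true, and_false, or_false, false_or, sub_eq_iff_eq_add]

theorem eq_of_forall_eq_pred {X : Type*} {f : ℤ → X} (hf : ∀ y, f y = f (y - 1)) (a b : ℤ) :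
    f a = f b := by
  have hper : Function.Periodic f 1 := fun y => by rw [hf (y + 1), add_sub_cancel_right]
  have hzero (a : ℤ) : f a = f 0 := by simpa using hper.int_mul_eq a
  rw [hzero a, hzero b]

theorem exists_box_of_finite_support {w : LatticeEdge → ℤ} (hw : w.support.Finite) :
    ∃ N : ℤ, ∀ p b, N < |p.1| ∨ N < |p.2| → w (p, b) = 0 := by
  obtain ⟨N, hN⟩ := (hw.image fun e => max |e.1.1| |e.1.2|).bddAbove
  refine ⟨N, fun p b hp => by_contra fun hne => ?_⟩
  have hle : max |p.1| |p.2| ≤ N := hN ⟨(p, b), hne, rfl⟩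
  rw [max_le_iff] at hle
  omega

/-- The flow of `w` across the part above height `-N` of the vertical half-line going down from the
unit square `p`: the potential of a flow that vanishes below height `-N`. -/
noncomputable def downwardFlux (N : ℤ) (w : LatticeEdge → ℤ) (p : ℤ × ℤ) : ℤ :=
  ∑ j ∈ Finset.Icc (-N) p.2, w ((p.1, j), false)

section DownwardFlux

variable {N : ℤ} {w : LatticeEdge → ℤ} (hw : ∀ p b, N < |p.1| ∨ N < |p.2| → w (p, b) = 0)

theorem downwardFlux_of_lt (N : ℤ) (w : LatticeEdge → ℤ) {p : ℤ × ℤ} (hp : p.2 < -N) :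
    downwardFlux N w p = 0 := by
  rw [downwardFlux, Finset.Icc_eq_empty (by omega), Finset.sum_empty]

include hw

theorem downwardFlux_sub_downwardFlux (p : ℤ × ℤ) :
    downwardFlux N w p - downwardFlux N w (p.1, p.2 - 1) = w (p, false) := by
  by_cases hp : -N ≤ p.2
  · have hins : Finset.Icc (-N) p.2 = insert p.2 (Finset.Icc (-N) (p.2 - 1)) := by
      ext j
      simp only [Finset.mem_Icc, Finset.mem_insert]
      omega
    rw [downwardFlux, hins, Finset.sum_insert (by simp), downwardFlux, add_sub_cancel_right]
  · rw [downwardFlux_of_lt N w (by omega), downwardFlux_of_lt N w (by simp only; omega),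
      hw p false (by rw [lt_abs, lt_abs]; omega), sub_zero]

theorem latticeBoundary_downwardFlux (hflow : ∀ p, latticeInflow w p = 0) :
    latticeBoundary (downwardFlux N w) = w := by
  funext ⟨⟨x, y⟩, b⟩
  cases b
  · exact downwardFlux_sub_downwardFlux hw (x, y)
  let defect (j : ℤ) : ℤ :=
    latticeBoundary (downwardFlux N w) ((x, j), true) - w ((x, j), true)
  have hconst (j : ℤ) : defect j = defect (j - 1) := by
    have hin := hflow (x, j)
    have hright := downwardFlux_sub_downwardFlux hw (x, j)
    have hleft := downwardFlux_sub_downwardFlux hw (x - 1, j)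
    simp only [latticeInflow, latticeBoundary, defect] at hin hright hleft ⊢
    linarith
  have hlow : defect (-N - 1) = 0 := by
    have hN : N < |-N - 1| := by rw [lt_abs]; omega
    simp only [defect, latticeBoundary]
    rw [downwardFlux_of_lt N w (by simp), downwardFlux_of_lt N w (by simp),
      hw _ _ (Or.inr hN), sub_zero, sub_zero]
  exact sub_eq_zero.1 ((eq_of_forall_eq_pred hconst y (-N - 1)).trans hlow)

theorem support_downwardFlux_subset (hflow : ∀ p, latticeInflow w p = 0) :
    (downwardFlux N w).support ⊆ Icc (-N) N ×ˢ Icc (-N) N := by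
  have hcol (p : ℤ × ℤ) (hp : N < |p.1|) : downwardFlux N w p = 0 :=
    Finset.sum_eq_zero fun j _ => hw _ _ (Or.inl hp)
  have hrow (x y : ℤ) (hy : N < |y|) : downwardFlux N w (x, y) = 0 := by
    have hpred (x : ℤ) : downwardFlux N w (x, y) = downwardFlux N w (x - 1, y) := by
      have hup := congrFun (latticeBoundary_downwardFlux hw hflow) ((x, y), true)
      rw [hw _ _ (Or.inr hy)] at hup
      exact (sub_eq_zero.1 hup).symm
    rw [eq_of_forall_eq_pred hpred x (-N - 1)]
    exact hcol _ (by rw [lt_abs]; simp only; omega)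
  intro p hp
  rw [mem_prod, mem_Icc, mem_Icc, ← abs_le, ← abs_le]
  exact ⟨not_lt.1 fun h => hp (hcol p h), not_lt.1 fun h => hp (hrow p.1 p.2 h)⟩

end DownwardFlux

theorem exists_latticeBoundary_eq {w : LatticeEdge → ℤ} (hw : w.support.Finite)
    (hflow : ∀ p, latticeInflow w p = 0) :
    ∃ c : ℤ × ℤ → ℤ, c.support.Finite ∧ latticeBoundary c = w := by
  obtain ⟨N, hN⟩ := exists_box_of_finite_support hw
  exact ⟨downwardFlux N w, ((finite_Icc _ _).prod (finite_Icc _ _)).subset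
    (support_downwardFlux_subset hN hflow), latticeBoundary_downwardFlux hN hflow⟩

theorem eq_zero_of_latticeBoundary_eq_zero {c : ℤ × ℤ → ℤ} (hc : c.support.Finite)
    (h : latticeBoundary c = 0) : c = 0 := by
  funext p
  obtain ⟨y, hy⟩ := (hc.image Prod.snd).exists_notMem
  have hpred (y : ℤ) : c (p.1, y) = c (p.1, y - 1) :=
    sub_eq_zero.1 (congrFun h ((p.1, y), false))
  rw [show c p = c (p.1, y) from eq_of_forall_eq_pred hpred p.2 y]
  exact by_contra fun hne => hy ⟨(p.1, y), hne, rfl⟩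

end LatticeChains

section SimplyConnectedGrids

open Set Matrix

variable {G : squareLattice.Subgraph}

/-- The edges of `G` with their lattice orientation. -/
def orientedEdges (G : squareLattice.Subgraph) : Set LatticeEdge :=
  {e | G.Adj e.1 (edgeHead e)}

/-- The starting point of an edge of `G`, as a vertex of `G`. -/
def edgeSource (e : orientedEdges G) : G.verts := ⟨e.1.1, G.edge_vert e.2⟩

/-- The endpoint of an edge of `G`, as a vertex of `G`. -/
def edgeTarget (e : orientedEdges G) : G.verts :=
  ⟨edgeHead e.1, SimpleGraph.Subgraph.Adj.snd_mem e.2⟩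

/-- `G` is a finite connected graph whose faces fill every cycle: all integer flows in `G` are
boundaries of chains of faces of `G`. -/
structure IsSimplyConnectedGrid (G : squareLattice.Subgraph) : Prop where
  finite_verts : G.verts.Finite
  connected : G.coe.Connected
  exists_latticeBoundary_eq : ∀ w : LatticeEdge → ℤ, w.support ⊆ orientedEdges G →
    (∀ p, latticeInflow w p = 0) → ∃ c, c.support ⊆ gridFaces G ∧ latticeBoundary c = w

/-- The matrix of the cellular boundary map of `G`. -/
def faceMatrix (G : squareLattice.Subgraph) : Matrix (gridFaces G) (orientedEdges G) ℤ :=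
  Matrix.of fun f e => latticeBoundary (Pi.single f.1 1) e

theorem finite_orientedEdges (hG : G.verts.Finite) : (orientedEdges G).Finite :=
  (hG.prod (finite_univ (α := Bool))).subset fun _ he => ⟨G.edge_vert he, mem_univ _⟩

theorem finite_gridFaces (hG : G.verts.Finite) : (gridFaces G).Finite :=
  hG.subset fun _ hp => G.edge_vert hp.1

theorem mk_edgeSource_edgeTarget_injective :
    Function.Injective fun e : orientedEdges G => s(edgeSource e, edgeTarget e) :=
  fun _ _ h => Subtype.ext (injective_mk_edgeHead (congrArg (Sym2.map Subtype.val) h))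

theorem edgeSource_ne_edgeTarget (e : orientedEdges G) : edgeSource e ≠ edgeTarget e :=
  fun h => ne_edgeHead e.1 (congrArg Subtype.val h)

theorem edgeGraph_univ_eq_coe :
    edgeGraph (edgeSource (G := G)) edgeTarget univ = G.coe := by
  ext ⟨p, hp⟩ ⟨q, hq⟩
  rw [SimpleGraph.Subgraph.coe_adj]
  constructor
  · intro h
    obtain ⟨⟨e, he⟩, -, ⟨hs, ht⟩ | ⟨hs, ht⟩⟩ := exists_of_edgeGraph_adj h <;>
      rw [← congrArg Subtype.val hs, ← congrArg Subtype.val ht]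
    exacts [he, SimpleGraph.Subgraph.Adj.symm he]
  · intro h
    obtain ⟨e, ⟨rfl, rfl⟩ | ⟨rfl, rfl⟩⟩ := exists_latticeEdge_of_adj h.adj_sub
    · exact edgeGraph_adj_of_mem edgeSource_ne_edgeTarget (mem_univ (⟨e, h⟩ : orientedEdges G))
    · exact (edgeGraph_adj_of_mem edgeSource_ne_edgeTarget
        (mem_univ (⟨e, h.symm⟩ : orientedEdges G))).symm

theorem sum_coe_ite_mem {X R : Type*} [AddCommMonoid R] [DecidableEq X] {S : Set X} [Fintype S]
    {w : X → R} {T : Finset X} (hT : ∀ x ∈ T, x ∉ S → w x = 0) :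
    ∑ x : S, (if x.1 ∈ T then w x else 0) = ∑ x ∈ T, w x := by
  classical
  rw [← Finset.sum_filter]
  refine Finset.sum_bij_ne_zero (fun x _ _ => x.1) (fun x hx _ => (Finset.mem_filter.1 hx).2)
    (fun x _ _ y _ _ h => Subtype.ext h) (fun x hx hne => ?_) fun _ _ _ => rfl
  exact ⟨⟨x, by_contra fun h => hne (hT x hx h)⟩,
    Finset.mem_filter.2 ⟨Finset.mem_univ _, hx⟩, hne, rfl⟩

theorem vecMul_signedIncidence_apply [Fintype (orientedEdges G)] {w : LatticeEdge → ℤ}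
    (hw : w.support ⊆ orientedEdges G) (v : G.verts) :
    ((fun e : orientedEdges G => w e) ᵥ* signedIncidence edgeSource edgeTarget) v =
      latticeInflow w v := by
  have hzero {T : Finset LatticeEdge} : ∀ e ∈ T, e ∉ orientedEdges G → w e = 0 :=
    fun e _ he => Function.notMem_support.1 fun h => he (hw h)
  calc ((fun e : orientedEdges G => w e) ᵥ* signedIncidence edgeSource edgeTarget) v
      = (∑ e : orientedEdges G, if edgeHead e.1 = v.1 then w e else 0) -
          ∑ e : orientedEdges G, if e.1.1 = v.1 then w e else 0 := by
        rw [← Finset.sum_sub_distrib]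
        refine Finset.sum_congr rfl fun e _ => ?_
        simp [signedIncidence, Pi.single_apply, mul_sub, Subtype.ext_iff, edgeSource, edgeTarget,
          eq_comm]
    _ = latticeInflow w v := by
        simp only [edgeHead_eq_iff, edgeTail_eq_iff]
        rw [sum_coe_ite_mem hzero, sum_coe_ite_mem hzero]
        simp [latticeInflow]

theorem vecMul_faceMatrix_apply [Fintype (gridFaces G)] {c : ℤ × ℤ → ℤ}
    (hc : c.support ⊆ gridFaces G) (e : orientedEdges G) :
    ((fun f : gridFaces G => c f) ᵥ* faceMatrix G) e = latticeBoundary c e := by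
  have hsum (p : ℤ × ℤ) : ∑ f : gridFaces G, c f * (Pi.single f.1 1 : ℤ × ℤ → ℤ) p = c p := by
    have hp := sum_coe_ite_mem (S := gridFaces G) (w := c) (T := {p})
      fun x _ hx => Function.notMem_support.1 fun h => hx (hc h)
    simpa [Pi.single_apply, eq_comm] using hp
  obtain ⟨⟨p, _ | _⟩, -⟩ := e <;>
  · simp only [vecMul, dotProduct, faceMatrix, of_apply, latticeBoundary, mul_sub,
      Finset.sum_sub_distrib, hsum]

theorem faceMatrix_mulVec_apply [Fintype (orientedEdges G)] (w : LatticeEdge → ℤ)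
    (f : gridFaces G) :
    (faceMatrix G *ᵥ fun e : orientedEdges G => w e) f = latticeCurl w f := by
  obtain ⟨hbottom, hright, htop, hleft⟩ := f.2
  simp only [mulVec, dotProduct, faceMatrix, of_apply, latticeBoundary_single, sub_mul, ite_mul,
    one_mul, zero_mul, Finset.sum_sub_distrib]
  rw [sum_coe_ite_mem, sum_coe_ite_mem]
  · simp [latticeCurl]
  · simp only [Finset.mem_insert, Finset.mem_singleton, forall_eq_or_imp, forall_eq]
    exact ⟨(absurd htop ·), (absurd hleft ·)⟩
  · simp only [Finset.mem_insert, Finset.mem_singleton, forall_eq_or_imp, forall_eq]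
    exact ⟨(absurd hbottom ·), (absurd hright ·)⟩

theorem support_latticeBoundary_subset {c : ℤ × ℤ → ℤ} (hc : c.support ⊆ gridFaces G) :
    (latticeBoundary c).support ⊆ orientedEdges G := by
  have hzero {p : ℤ × ℤ} (hp : p ∉ gridFaces G) : c p = 0 :=
    Function.notMem_support.1 fun h => hp (hc h)
  refine fun e => Function.mtr fun he => Function.notMem_support.2 ?_
  obtain ⟨⟨x, y⟩, _ | _⟩ := e
  · have habove : (x, y) ∉ gridFaces G := fun h => he h.1
    have hbelow : (x, y - 1) ∉ gridFaces G :=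
      fun h => he (by simpa [orientedEdges, edgeHead] using h.2.2.1)
    simp [latticeBoundary, hzero habove, hzero hbelow]
  · have hright : (x, y) ∉ gridFaces G := fun h => he h.2.2.2
    have hleft : (x - 1, y) ∉ gridFaces G :=
      fun h => he (by simpa [orientedEdges, edgeHead] using h.2.1)
    simp [latticeBoundary, hzero hright, hzero hleft]

theorem faceMatrix_mul_signedIncidence [Fintype (orientedEdges G)] :
    faceMatrix G * signedIncidence (edgeSource (G := G)) edgeTarget = 0 := by
  ext f v
  have hf : (Pi.single f.1 1 : ℤ × ℤ → ℤ).support ⊆ gridFaces G :=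
    Pi.support_single_subset.trans (singleton_subset_iff.2 f.2)
  exact (vecMul_signedIncidence_apply (support_latticeBoundary_subset hf) v).trans
    (latticeInflow_latticeBoundary _ _)

theorem eq_zero_of_vecMul_faceMatrix_eq_zero [Fintype (gridFaces G)] {c : gridFaces G → ℤ}
    (h : c ᵥ* faceMatrix G = 0) : c = 0 := by
  set C : ℤ × ℤ → ℤ := Function.extend Subtype.val c 0
  have hCc : (fun f : gridFaces G => C f) = c :=
    funext fun f => Subtype.val_injective.extend_apply c 0 f
  have hC : C.support ⊆ gridFaces G := fun p => Function.mtr fun hp => Function.notMem_support.2 <|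
    Function.extend_apply' _ _ _ fun ⟨f, hf⟩ => hp (hf ▸ f.2)
  have hboundary : latticeBoundary C = 0 := by
    funext e
    by_cases he : e ∈ orientedEdges G
    · rw [← vecMul_faceMatrix_apply hC ⟨e, he⟩, hCc, h]
      rfl
    · exact Function.notMem_support.1 fun hne => he (support_latticeBoundary_subset hC hne)
  rw [← hCc, eq_zero_of_latticeBoundary_eq_zero ((toFinite (gridFaces G)).subset hC) hboundary]
  rfl

theorem faceMatrix_mul_transpose [Fintype (orientedEdges G)]
    [DecidableEq (gridFaces G)] [DecidableRel (squareLattice.induce (gridFaces G)).Adj] :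
    faceMatrix G * (faceMatrix G)ᵀ =
      (4 : ℤ) • 1 - (squareLattice.induce (gridFaces G)).adjMatrix ℤ := by
  ext f f'
  have hcurl := (faceMatrix_mulVec_apply (latticeBoundary (Pi.single f'.1 1)) f).trans
    (latticeCurl_latticeBoundary _ _)
  refine (show _ = _ from hcurl).trans ?_
  simp only [Pi.single_apply, Finset.sum_ite_eq', Matrix.sub_apply, Matrix.smul_apply, one_apply,
    SimpleGraph.adjMatrix_apply, smul_eq_mul, Subtype.ext_iff]
  exact congrArg _ (if_congr mem_latticeNeighbors rfl rfl)

namespace IsSimplyConnectedGrid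

theorem exists_vecMul_faceMatrix_eq (hG : IsSimplyConnectedGrid G) [Fintype (gridFaces G)]
    [Fintype (orientedEdges G)] {z : orientedEdges G → ℤ}
    (hz : z ᵥ* signedIncidence edgeSource edgeTarget = 0) : ∃ c, c ᵥ* faceMatrix G = z := by
  set w : LatticeEdge → ℤ := Function.extend Subtype.val z 0
  have hwz : (fun e : orientedEdges G => w e) = z :=
    funext fun e => Subtype.val_injective.extend_apply z 0 e
  have hw : w.support ⊆ orientedEdges G := fun p => Function.mtr fun hp =>
    Function.notMem_support.2 <| Function.extend_apply' _ _ _ fun ⟨e, he⟩ => hp (he ▸ e.2)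
  have hflow (p : ℤ × ℤ) : latticeInflow w p = 0 := by
    by_cases hp : p ∈ G.verts
    · rw [← vecMul_signedIncidence_apply hw ⟨p, hp⟩, hwz, hz]
      rfl
    · have hzero {e : LatticeEdge} (he : e.1 = p ∨ edgeHead e = p) : w e = 0 := by
        refine Function.notMem_support.1 fun hne => hp ?_
        rcases he with rfl | rfl
        exacts [G.edge_vert (hw hne), SimpleGraph.Subgraph.Adj.snd_mem (hw hne)]
      rw [latticeInflow, hzero (Or.inr (by simp [edgeHead])), hzero (Or.inr (by simp [edgeHead])),
        hzero (Or.inl rfl), hzero (Or.inl rfl), add_zero, sub_zero]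
  obtain ⟨c, hc, hcw⟩ := hG.exists_latticeBoundary_eq w hw hflow
  refine ⟨fun f => c f, funext fun e => ?_⟩
  rw [vecMul_faceMatrix_apply hc, hcw, ← hwz]

theorem isCycleBasis_faceMatrix (hG : IsSimplyConnectedGrid G) [Fintype (gridFaces G)]
    [Fintype (orientedEdges G)] : IsCycleBasis edgeSource edgeTarget (faceMatrix G) where
  mul_signedIncidence := faceMatrix_mul_signedIncidence
  eq_zero_of_vecMul_eq_zero _ := eq_zero_of_vecMul_faceMatrix_eq_zero
  exists_vecMul_eq _ := hG.exists_vecMul_faceMatrix_eq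

theorem connected_edgeGraph (hG : IsSimplyConnectedGrid G) :
    (edgeGraph (edgeSource (G := G)) edgeTarget univ).Connected :=
  edgeGraph_univ_eq_coe ▸ hG.connected

theorem gridArea_add_ncard_verts (hG : IsSimplyConnectedGrid G) :
    gridArea G + G.verts.ncard = (orientedEdges G).ncard + 1 := by
  have := hG.finite_verts.fintype
  have := (finite_orientedEdges hG.finite_verts).fintype
  have := (finite_gridFaces hG.finite_verts).fintype
  have heuler := hG.isCycleBasis_faceMatrix.card_add_card_eq mk_edgeSource_edgeTarget_injective
    edgeSource_ne_edgeTarget hG.connected_edgeGraph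
  rwa [← Nat.card_eq_fintype_card, ← Nat.card_eq_fintype_card, ← Nat.card_eq_fintype_card]
    at heuler

theorem numSpanningTrees_eq_det (hG : IsSimplyConnectedGrid G) [Fintype (gridFaces G)]
    [DecidableEq (gridFaces G)] [DecidableRel (squareLattice.induce (gridFaces G)).Adj] :
    (numSpanningTrees G : ℝ) =
      ((4 : ℝ) • 1 - (squareLattice.induce (gridFaces G)).adjMatrix ℝ).det := by
  have := hG.finite_verts.fintype
  have := (finite_orientedEdges hG.finite_verts).fintype
  have htrees := hG.isCycleBasis_faceMatrix.ncard_spanningTrees_eq_det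
    mk_edgeSource_edgeTarget_injective edgeSource_ne_edgeTarget hG.connected_edgeGraph
  rw [edgeGraph_univ_eq_coe, faceMatrix_mul_transpose] at htrees
  have hcast := congrArg (Int.cast : ℤ → ℝ) htrees
  rw [Int.cast_natCast, Int.cast_det] at hcast
  refine hcast.trans (congrArg det ?_)
  ext f f'
  simp only [map_apply, Matrix.sub_apply, Matrix.smul_apply, one_apply,
    SimpleGraph.adjMatrix_apply, smul_eq_mul]
  push_cast
  rfl

end IsSimplyConnectedGrid

end SimplyConnectedGrids

section LoopRegions

open Set Filter Topology

theorem segment_latticePoint_right (a b : ℤ) :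
    segment ℝ (latticePoint (a, b)) (latticePoint (a + 1, b)) =
      Icc (a : ℝ) (a + 1) ×ˢ {(b : ℝ)} := by
  simp only [latticePoint, Int.cast_add, Int.cast_one]
  rw [← Prod.image_mk_segment_left, segment_eq_Icc (by linarith), prod_singleton]

theorem segment_latticePoint_up (a b : ℤ) :
    segment ℝ (latticePoint (a, b)) (latticePoint (a, b + 1)) =
      {(a : ℝ)} ×ˢ Icc (b : ℝ) (b + 1) := by
  simp only [latticePoint, Int.cast_add, Int.cast_one]
  rw [← Prod.image_mk_segment_right, segment_eq_Icc (by linarith), singleton_prod]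

theorem isometry_latticePoint : Isometry latticePoint :=
  Isometry.of_dist_eq fun p q => by simp [Prod.dist_eq, latticePoint]

theorem finite_of_isBounded_image_latticePoint {S : Set (ℤ × ℤ)}
    (hS : Bornology.IsBounded (latticePoint '' S)) : S.Finite :=
  ((isometry_latticePoint.antilipschitz.isBounded_preimage hS).subset
    (subset_preimage_image _ _)).isCompact_closure.finite_of_discrete.subset subset_closure

variable {v : ℤ × ℤ} {α : squareLattice.Walk v v}

theorem mem_loopTrace_iff {x : ℝ × ℝ} : x ∈ loopTrace α ↔ ∃ e : LatticeEdge,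
    s(e.1, edgeHead e) ∈ α.edges ∧
      x ∈ segment ℝ (latticePoint e.1) (latticePoint (edgeHead e)) := by
  refine ⟨fun ⟨p, q, hpq, hx⟩ => ?_, fun ⟨e, he, hx⟩ => ⟨_, _, he, hx⟩⟩
  obtain ⟨e, ⟨rfl, rfl⟩ | ⟨rfl, rfl⟩⟩ := exists_latticeEdge_of_adj (α.adj_of_mem_edges hpq)
  · exact ⟨e, hpq, hx⟩
  · exact ⟨e, by rwa [Sym2.eq_swap], by rwa [segment_symm]⟩

theorem isBounded_loopTrace (α : squareLattice.Walk v v) : Bornology.IsBounded (loopTrace α) := by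
  have hfin : (latticePoint '' {p | p ∈ α.support}).Finite := (α.support.finite_toSet).image _
  refine Bornology.IsBounded.subset (isBounded_convexHull.2 hfin.isBounded) ?_
  rintro x ⟨p, q, hpq, hx⟩
  exact segment_subset_convexHull
    (mem_image_of_mem latticePoint (α.fst_mem_support_of_mem_edges hpq))
    (mem_image_of_mem latticePoint (α.snd_mem_support_of_mem_edges hpq)) hx

theorem notMem_loopRegion {x : ℝ × ℝ} : x ∉ loopRegion α ↔
    x ∉ loopTrace α ∧ ¬ Bornology.IsBounded (connectedComponentIn (loopTrace α)ᶜ x) := by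
  simp only [loopRegion, loopInterior, mem_union, mem_ofPred_eq]
  tauto

theorem connectedComponentIn_subset_compl_loopRegion {x : ℝ × ℝ} (hx : x ∉ loopRegion α) :
    connectedComponentIn (loopTrace α)ᶜ x ⊆ (loopRegion α)ᶜ := fun _ hy =>
  notMem_loopRegion.2 ⟨connectedComponentIn_subset _ _ hy,
    connectedComponentIn_eq hy ▸ (notMem_loopRegion.1 hx).2⟩

theorem mem_loopRegion_of_isPreconnected {x y : ℝ × ℝ} {S : Set (ℝ × ℝ)} (hS : IsPreconnected S)
    (hdisj : S ⊆ (loopTrace α)ᶜ) (hxS : x ∈ S) (hyS : y ∈ S) (hx : x ∈ loopRegion α) :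
    y ∈ loopRegion α :=
  by_contra fun hy => connectedComponentIn_subset_compl_loopRegion hy
    (hS.subset_connectedComponentIn hyS hdisj hxS) hx

theorem isBounded_loopRegion (α : squareLattice.Walk v v) :
    Bornology.IsBounded (loopRegion α) := by
  obtain ⟨R, hR, htrace⟩ := (isBounded_loopTrace α).exists_pos_norm_le
  refine isBounded_iff_forall_norm_le.2 ⟨R, fun x hx => by_contra fun hxR => ?_⟩
  rw [not_le] at hxR
  have hnorm {t : ℝ} (ht : 0 ≤ t) : ‖x + t • x‖ = (1 + t) * ‖x‖ := by
    rw [show x + t • x = (1 + t) • x by rw [add_smul, one_smul], norm_smul,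
      Real.norm_of_nonneg (by linarith)]
  have hray : IsPreconnected ((fun t : ℝ => x + t • x) '' Ici 0) :=
    isPreconnected_Ici.image _ (by fun_prop)
  have hsub : (fun t : ℝ => x + t • x) '' Ici 0 ⊆ connectedComponentIn (loopTrace α)ᶜ x := by
    refine hray.subset_connectedComponentIn ⟨0, self_mem_Ici, by simp⟩ ?_
    rintro _ ⟨t, ht, rfl⟩ hmem
    have hle := htrace _ hmem
    rw [hnorm ht] at hle
    nlinarith [mul_nonneg (mem_Ici.1 ht) (norm_nonneg x)]
  have hxtrace : x ∉ loopTrace α := fun h => hxR.not_ge (htrace x h)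
  obtain ⟨C, hC, hcomp⟩ := (hx.resolve_left hxtrace).2.exists_pos_norm_le
  have hxpos : 0 < ‖x‖ := hR.trans hxR
  have hle := hcomp _ (hsub ⟨C / ‖x‖, div_nonneg hC.le hxpos.le, rfl⟩)
  rw [hnorm (div_nonneg hC.le hxpos.le), add_mul, div_mul_cancel₀ _ hxpos.ne'] at hle
  linarith

theorem latticePoint_floor_mem_loopTrace {x : ℝ} {b : ℤ} (hx : (x, (b : ℝ)) ∈ loopTrace α) :
    latticePoint (⌊x⌋, b) ∈ loopTrace α := by
  obtain ⟨⟨⟨p, q⟩, _ | _⟩, he, hseg⟩ := mem_loopTrace_iff.1 hx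
  · rw [edgeHead, segment_latticePoint_right] at hseg
    obtain ⟨⟨hle, hlt⟩, hb⟩ := hseg
    obtain rfl : b = q := Int.cast_injective (α := ℝ) hb
    rcases hlt.lt_or_eq with hlt | heq
    · rw [Int.floor_eq_iff.2 ⟨hle, hlt⟩]
      exact ⟨_, _, he, left_mem_segment ℝ _ _⟩
    · obtain rfl : x = ((p + 1 : ℤ) : ℝ) := by simpa using heq
      rw [Int.floor_intCast]
      exact ⟨_, _, he, right_mem_segment ℝ _ _⟩
  · rw [edgeHead, segment_latticePoint_up] at hseg
    obtain rfl : x = p := hseg.1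
    rwa [Int.floor_intCast]

theorem mem_support_of_latticePoint_mem_loopTrace {p : ℤ × ℤ} (hp : latticePoint p ∈ loopTrace α) :
    p ∈ α.support := by
  obtain ⟨x, y⟩ := p
  obtain ⟨⟨⟨a, b⟩, _ | _⟩, he, hseg⟩ := mem_loopTrace_iff.1 hp
  · rw [edgeHead, segment_latticePoint_right, latticePoint] at hseg
    obtain ⟨⟨hle, hge⟩, hb⟩ := hseg
    obtain rfl : y = b := Int.cast_injective (α := ℝ) hb
    simp only at hle hge
    norm_cast at hle hge
    obtain rfl | rfl : x = a ∨ x = a + 1 := by omega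
    exacts [α.fst_mem_support_of_mem_edges he, α.snd_mem_support_of_mem_edges he]
  · rw [edgeHead, segment_latticePoint_up, latticePoint] at hseg
    obtain ⟨ha, hle, hge⟩ := hseg
    obtain rfl : x = a := Int.cast_injective (α := ℝ) ha
    simp only at hle hge
    norm_cast at hle hge
    obtain rfl | rfl : y = b ∨ y = b + 1 := by omega
    exacts [α.fst_mem_support_of_mem_edges he, α.snd_mem_support_of_mem_edges he]

/-- `G` is the graph of all lattice points and lattice edges in the region of the closed walk `α`,
which need not be simple. -/
structure IsLoopRegionGraph (α : squareLattice.Walk v v) (G : squareLattice.Subgraph) : Prop where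
  mem_verts_iff : ∀ p, p ∈ G.verts ↔ latticePoint p ∈ loopRegion α
  adj_iff : ∀ p q, G.Adj p q ↔
    squareLattice.Adj p q ∧ segment ℝ (latticePoint p) (latticePoint q) ⊆ loopRegion α

/-- The bottom-left corner of the half-open unit square that contains `x`. -/
noncomputable def floorPoint (x : ℝ × ℝ) : ℤ × ℤ := (⌊x.1⌋, ⌊x.2⌋)

/-- The closed unit square with bottom-left corner `p`. -/
def closedCell (p : ℤ × ℤ) : Set (ℝ × ℝ) := Icc (p.1 : ℝ) (p.1 + 1) ×ˢ Icc (p.2 : ℝ) (p.2 + 1)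

theorem isBounded_closedCell (p : ℤ × ℤ) : Bornology.IsBounded (closedCell p) :=
  (Metric.isBounded_Icc _ _).prod (Metric.isBounded_Icc _ _)

theorem mem_closedCell_floorPoint (x : ℝ × ℝ) : x ∈ closedCell (floorPoint x) :=
  ⟨⟨Int.floor_le _, (Int.lt_floor_add_one _).le⟩, ⟨Int.floor_le _, (Int.lt_floor_add_one _).le⟩⟩

theorem eventually_mem_Icc_floor (r : ℝ) : ∀ᶠ s in 𝓝 r, r ∈ Icc (⌊s⌋ : ℝ) (⌊s⌋ + 1) := by
  rw [← nhdsLT_sup_nhdsGE, eventually_sup]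
  constructor
  · filter_upwards [tendsto_pure.1 (tendsto_floor_left_pure_ceil_sub_one r)] with s hs
    rw [hs]
    push_cast
    exact ⟨by linarith [Int.ceil_lt_add_one r], by linarith [Int.le_ceil r]⟩
  · filter_upwards [tendsto_pure.1 (tendsto_floor_right_pure_floor r)] with s hs
    rw [hs]
    exact ⟨Int.floor_le r, (Int.lt_floor_add_one r).le⟩

theorem eventually_mem_closedCell_floorPoint (x : ℝ × ℝ) :
    ∀ᶠ y in 𝓝 x, x ∈ closedCell (floorPoint y) := by
  filter_upwards [(continuous_fst.tendsto x).eventually (eventually_mem_Icc_floor x.1),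
    (continuous_snd.tendsto x).eventually (eventually_mem_Icc_floor x.2)] with y h₁ h₂
  exact ⟨h₁, h₂⟩

theorem isBounded_preimage_floorPoint {S : Set (ℤ × ℤ)} (hS : S.Finite) :
    Bornology.IsBounded (floorPoint ⁻¹' S) :=
  ((Bornology.isBounded_biUnion hS).2 fun p _ => isBounded_closedCell p).subset fun x hx =>
    mem_biUnion hx (mem_closedCell_floorPoint x)

namespace IsLoopRegionGraph

variable {G : squareLattice.Subgraph}

theorem finite_verts (hG : IsLoopRegionGraph α G) : G.verts.Finite := by
  refine finite_of_isBounded_image_latticePoint ((isBounded_loopRegion α).subset ?_)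
  rintro _ ⟨p, hp, rfl⟩
  exact (hG.mem_verts_iff p).1 hp

theorem toSubgraph_le (hG : IsLoopRegionGraph α G) (hα : ¬ α.Nil) : α.toSubgraph ≤ G :=
  (SimpleGraph.Walk.toSubgraph_le_iff hα).2 fun e => e.ind fun p q h =>
    (hG.adj_iff p q).2 ⟨α.adj_of_mem_edges h, fun _ hx => Or.inl ⟨p, q, h, hx⟩⟩

theorem adj_right (hG : IsLoopRegionGraph α G) {a b : ℤ} (hp : (a, b) ∈ G.verts)
    (htrace : latticePoint (a, b) ∉ loopTrace α) : G.Adj (a, b) (a + 1, b) := by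
  refine (hG.adj_iff _ _).2 ⟨squareLattice_adj_right a b, ?_⟩
  rw [segment_latticePoint_right]
  rintro ⟨y, _⟩ ⟨⟨hay, hya⟩, rfl⟩
  refine or_iff_not_imp_left.2 fun hy => Or.resolve_left ?_ hy
  refine mem_loopRegion_of_isPreconnected (x := latticePoint (a, b))
    (S := Icc (a : ℝ) y ×ˢ {(b : ℝ)})
    (isPreconnected_Icc.prod isPreconnected_singleton) ?_ ⟨left_mem_Icc.2 hay, rfl⟩
    ⟨right_mem_Icc.2 hay, rfl⟩ ((hG.mem_verts_iff _).1 hp)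
  rintro ⟨x, _⟩ ⟨⟨hax, hxy⟩, rfl⟩ hx
  rcases hxy.lt_or_eq with hlt | rfl
  · have hfloor := latticePoint_floor_mem_loopTrace hx
    rw [Int.floor_eq_iff.2 ⟨hax, hlt.trans_le hya⟩] at hfloor
    exact htrace hfloor
  · exact hy hx

/-- Walking to the right from a vertex of the bounded region, one has to meet the loop. -/
theorem exists_reachable_mem_loopTrace (hG : IsLoopRegionGraph α G) (p : G.verts) :
    ∃ q : G.verts, latticePoint q ∈ loopTrace α ∧ G.coe.Reachable p q := by
  by_contra! hno
  have hwalk (k : ℕ) : ∃ hk : (p.1.1 + (k : ℤ), p.1.2) ∈ G.verts, G.coe.Reachable p ⟨_, hk⟩ := by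
    induction k with
    | zero => simp
    | succ k ih =>
      obtain ⟨hk, hreach⟩ := ih
      have hadj := hG.adj_right hk fun h => hno _ h hreach
      simp only [Nat.cast_add, Nat.cast_one, ← add_assoc]
      exact ⟨hadj.snd_mem, hreach.trans hadj.coe.reachable⟩
  refine infinite_of_injective_forall_mem (fun k l hkl => ?_) (fun k => (hwalk k).1) hG.finite_verts
  simpa using hkl

theorem connected (hG : IsLoopRegionGraph α G) (hα : ¬ α.Nil) : G.coe.Connected := by
  have hle := hG.toSubgraph_le hα
  have hv : v ∈ α.toSubgraph.verts := by simp
  refine SimpleGraph.connected_iff_exists_forall_reachable _ |>.2 ⟨⟨v, hle.1 hv⟩, fun p => ?_⟩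
  obtain ⟨q, hq, hpq⟩ := hG.exists_reachable_mem_loopTrace p
  have hqα : q.1 ∈ α.toSubgraph.verts := by
    simpa using mem_support_of_latticePoint_mem_loopTrace hq
  have hvq := α.toSubgraph_connected.coe.preconnected ⟨v, hv⟩ ⟨q, hqα⟩
  exact (hvq.map (SimpleGraph.Subgraph.inclusion hle)).trans hpq.symm

section Potential

variable {c : ℤ × ℤ → ℤ} (hG : IsLoopRegionGraph α G)
  (hc : (latticeBoundary c).support ⊆ orientedEdges G)

include hG hc

theorem eq_left_of_notMem_loopRegion {x : ℝ × ℝ} (hx : x ∉ loopRegion α) {p : ℤ × ℤ}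
    (hp : x ∈ {(p.1 : ℝ)} ×ˢ Icc (p.2 : ℝ) (p.2 + 1)) : c (p.1 - 1, p.2) = c p := by
  by_contra hne
  have hadj : G.Adj p (p.1, p.2 + 1) := hc (a := (p, true)) (sub_ne_zero.2 hne)
  exact hx (((hG.adj_iff _ _).1 hadj).2 (segment_latticePoint_up p.1 p.2 ▸ hp))

theorem eq_below_of_notMem_loopRegion {x : ℝ × ℝ} (hx : x ∉ loopRegion α) {p : ℤ × ℤ}
    (hp : x ∈ Icc (p.1 : ℝ) (p.1 + 1) ×ˢ {(p.2 : ℝ)}) : c p = c (p.1, p.2 - 1) := by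
  by_contra hne
  have hadj : G.Adj p (p.1 + 1, p.2) := hc (a := (p, false)) (sub_ne_zero.2 hne)
  exact hx (((hG.adj_iff _ _).1 hadj).2 (segment_latticePoint_right p.1 p.2 ▸ hp))

theorem eq_floorPoint_of_notMem_loopRegion {x : ℝ × ℝ} (hx : x ∉ loopRegion α) {p : ℤ × ℤ}
    (hp : x ∈ closedCell p) : c p = c (floorPoint x) := by
  obtain ⟨a, b⟩ := p
  obtain ⟨⟨hax, hxa⟩, hby⟩ := hp
  have hhor : c (a, b) = c (⌊x.1⌋, b) := by
    rcases hxa.lt_or_eq with hlt | heq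
    · rw [Int.floor_eq_iff.2 ⟨hax, hlt⟩]
    · have hx₁ : x.1 = ((a + 1 : ℤ) : ℝ) := by simpa using heq
      rw [hx₁, Int.floor_intCast]
      simpa using hG.eq_left_of_notMem_loopRegion hc hx (p := (a + 1, b)) ⟨hx₁, hby⟩
  have hver : c (⌊x.1⌋, b) = c (⌊x.1⌋, ⌊x.2⌋) := by
    rcases hby.2.lt_or_eq with hlt | heq
    · rw [Int.floor_eq_iff.2 ⟨hby.1, hlt⟩]
    · have hx₂ : x.2 = ((b + 1 : ℤ) : ℝ) := by simpa using heq
      rw [hx₂, Int.floor_intCast]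
      simpa using (hG.eq_below_of_notMem_loopRegion hc hx (p := (⌊x.1⌋, b + 1))
        ⟨(mem_closedCell_floorPoint x).1, hx₂⟩).symm
  exact hhor.trans hver

theorem floorPoint_eq_zero_of_notMem_loopRegion (hfin : c.support.Finite) {x : ℝ × ℝ}
    (hx : x ∉ loopRegion α) : c (floorPoint x) = 0 := by
  set C := connectedComponentIn (loopTrace α)ᶜ x
  have hCout : C ⊆ (loopRegion α)ᶜ := connectedComponentIn_subset_compl_loopRegion hx
  obtain ⟨hxtrace, hunbounded⟩ := notMem_loopRegion.1 hx
  have hcont : ContinuousOn (fun y => c (floorPoint y)) C := fun y hy =>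
    tendsto_nhds_of_eventually_eq <| nhdsWithin_le_nhds <|
      (eventually_mem_closedCell_floorPoint y).mono fun z hz =>
        hG.eq_floorPoint_of_notMem_loopRegion hc (hCout hy) hz
  by_contra hne
  refine hunbounded ((isBounded_preimage_floorPoint hfin).subset fun y hy => ?_)
  rw [mem_preimage, Function.mem_support]
  rwa [isPreconnected_connectedComponentIn.constant hcont hy (mem_connectedComponentIn hxtrace)]

theorem support_subset_gridFaces (hfin : c.support.Finite) : c.support ⊆ gridFaces G := by
  rintro ⟨a, b⟩ hp
  have hcell : closedCell (a, b) ⊆ loopRegion α := fun x hx => by_contra fun hout => hp <|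
    (hG.eq_floorPoint_of_notMem_loopRegion hc hout hx).trans
      (hG.floorPoint_eq_zero_of_notMem_loopRegion hc hfin hout)
  have ha : (a : ℝ) ≤ a + 1 := by linarith
  have hb : (b : ℝ) ≤ b + 1 := by linarith
  refine ⟨(hG.adj_iff _ _).2 ⟨squareLattice_adj_right a b, ?_⟩,
    (hG.adj_iff _ _).2 ⟨squareLattice_adj_up (a + 1) b, ?_⟩,
    (hG.adj_iff _ _).2 ⟨squareLattice_adj_right a (b + 1), ?_⟩,
    (hG.adj_iff _ _).2 ⟨squareLattice_adj_up a b, ?_⟩⟩ <;>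
  refine Subset.trans ?_ hcell
  · rw [segment_latticePoint_right]
    exact prod_mono_right (singleton_subset_iff.2 (left_mem_Icc.2 hb))
  · rw [segment_latticePoint_up, Int.cast_add, Int.cast_one]
    exact prod_mono_left (singleton_subset_iff.2 (right_mem_Icc.2 ha))
  · rw [segment_latticePoint_right, Int.cast_add, Int.cast_one]
    exact prod_mono_right (singleton_subset_iff.2 (right_mem_Icc.2 hb))
  · rw [segment_latticePoint_up]
    exact prod_mono_left (singleton_subset_iff.2 (left_mem_Icc.2 ha))

end Potential

end IsLoopRegionGraph

theorem IsSimpleGridGraph.isSimplyConnectedGrid {G : squareLattice.Subgraph}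
    (hG : IsSimpleGridGraph G) : IsSimplyConnectedGrid G := by
  obtain ⟨v, α, hα, hverts, hadj⟩ := hG
  have hregion : IsLoopRegionGraph α G := ⟨hverts, hadj⟩
  refine ⟨hregion.finite_verts, hregion.connected hα.not_nil, fun w hw hflow => ?_⟩
  obtain ⟨c, hfin, rfl⟩ := exists_latticeBoundary_eq
    ((finite_orientedEdges hregion.finite_verts).subset hw) hflow
  exact ⟨c, hregion.support_subset_gridFaces hw hfin, rfl⟩

end LoopRegions

section CatalanIntegrals

open Real Set Filter Topology

theorem normSq_one_add_mul_exp (r u : ℝ) :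
    Complex.normSq (1 + r * Complex.exp ((2 * u : ℝ) * Complex.I)) =
      1 + 2 * (r * cos (2 * u)) + r ^ 2 := by
  rw [Complex.normSq_apply]
  simp only [Complex.add_re, Complex.add_im, Complex.one_re, Complex.one_im,
    Complex.re_ofReal_mul, Complex.im_ofReal_mul, Complex.exp_ofReal_mul_I_re,
    Complex.exp_ofReal_mul_I_im]
  linear_combination r ^ 2 * sin_sq_add_cos_sq (2 * u)

theorem hasSum_log_one_add_two_mul_cos {r : ℝ} (hr : |r| < 1) (u : ℝ) :
    HasSum (fun n : ℕ => (-1 : ℝ) ^ (n + 1) * r ^ n / n * cos (2 * n * u))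
      (1 / 2 * log (1 + 2 * (r * cos (2 * u)) + r ^ 2)) := by
  set z : ℂ := r * Complex.exp ((2 * u : ℝ) * Complex.I) with hz
  have hznorm : ‖z‖ < 1 := by
    rwa [hz, norm_mul, Complex.norm_exp_ofReal_mul_I, mul_one, Complex.norm_real]
  have hlog : (Complex.log (1 + z)).re = 1 / 2 * log (1 + 2 * (r * cos (2 * u)) + r ^ 2) := by
    rw [Complex.log_re, ← normSq_one_add_mul_exp, ← hz, Complex.normSq_eq_norm_sq, Real.log_pow]
    push_cast
    ring
  have hterm (n : ℕ) : (-1 : ℂ) ^ (n + 1) * z ^ n / n =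
      (((-1 : ℝ) ^ (n + 1) * r ^ n / n : ℝ) : ℂ) *
        Complex.exp ((2 * n * u : ℝ) * Complex.I) := by
    rw [hz, mul_pow, ← Complex.exp_nat_mul]
    push_cast
    rw [show (n : ℂ) * (2 * u * Complex.I) = 2 * n * u * Complex.I by ring]
    ring
  rw [← hlog]
  convert Complex.hasSum_re (Complex.hasSum_taylorSeries_log hznorm) using 2 with n
  rw [hterm, Complex.re_ofReal_mul, Complex.exp_ofReal_mul_I_re]

theorem integral_cos_two_mul {n : ℕ} (hn : n ≠ 0) :
    ∫ u in (0 : ℝ)..π / 4, cos (2 * n * u) = sin (n * (π / 2)) / (2 * n) := by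
  have hn' : (2 * n : ℝ) ≠ 0 := by positivity
  rw [intervalIntegral.integral_comp_mul_left (fun x => cos x) hn', integral_cos, mul_zero,
    sin_zero, sub_zero, smul_eq_mul, inv_mul_eq_div]
  congr 2
  ring

/-- The Taylor coefficients in `r` of the integral of `log |1 + r exp (2 i u)|` over `[0, π / 4]`.
-/
noncomputable def catalanCoeff (n : ℕ) : ℝ := (-1) ^ (n + 1) / n * (sin (n * (π / 2)) / (2 * n))

theorem catalanCoeff_two_mul (k : ℕ) : catalanCoeff (2 * k) = 0 := by
  have hsin : sin (((2 * k : ℕ) : ℝ) * (π / 2)) = 0 := by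
    rw [show ((2 * k : ℕ) : ℝ) * (π / 2) = k * π by push_cast; ring, sin_nat_mul_pi]
  rw [catalanCoeff, hsin, zero_div, mul_zero]

theorem catalanCoeff_two_mul_add_one (k : ℕ) :
    catalanCoeff (2 * k + 1) = (-1) ^ k / (2 * (k : ℝ) + 1) ^ 2 / 2 := by
  have hsin : sin (((2 * k + 1 : ℕ) : ℝ) * (π / 2)) = (-1) ^ k := by
    rw [show ((2 * k + 1 : ℕ) : ℝ) * (π / 2) = π / 2 + k * π by push_cast; ring,
      sin_add_nat_mul_pi, sin_pi_div_two, mul_one]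
  have hsign : (-1 : ℝ) ^ (2 * k + 1 + 1) = 1 := Even.neg_one_pow ⟨k + 1, by ring⟩
  rw [catalanCoeff, hsin, hsign]
  push_cast
  field_simp

theorem hasSum_catalanCoeff : HasSum catalanCoeff (catalanC / 2) := by
  have hinj : Function.Injective fun k : ℕ => 2 * k + 1 := fun k l h => by simpa using h
  have hsummable : Summable fun k : ℕ => (-1 : ℝ) ^ k / (2 * (k : ℝ) + 1) ^ 2 := by
    refine .of_norm ?_
    simpa [Function.comp_def] using
      (Real.summable_one_div_nat_pow.2 one_lt_two).comp_injective hinj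
  refine (hinj.hasSum_iff fun n hn => ?_).1
    ((hsummable.hasSum.div_const 2).congr_fun catalanCoeff_two_mul_add_one)
  obtain ⟨k, rfl | rfl⟩ := n.even_or_odd'
  · exact catalanCoeff_two_mul k
  · exact absurd ⟨k, rfl⟩ hn

theorem hasSum_integral_log_one_add_two_mul_cos {r : ℝ} (hr : |r| < 1) :
    HasSum (fun n => catalanCoeff n * r ^ n)
      (∫ u in (0 : ℝ)..π / 4, 1 / 2 * log (1 + 2 * (r * cos (2 * u)) + r ^ 2)) := by
  have hbound (n : ℕ) (u : ℝ) : ‖(-1 : ℝ) ^ (n + 1) * r ^ n / n * cos (2 * n * u)‖ ≤ |r| ^ n := by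
    rw [norm_mul, norm_div, norm_mul, norm_pow, norm_neg, norm_one, one_pow, one_mul, norm_pow,
      Real.norm_eq_abs, Real.norm_natCast, ← mul_one (|r| ^ n)]
    refine mul_le_mul ?_ (abs_cos_le_one _) (abs_nonneg _) (by positivity)
    rcases n.eq_zero_or_pos with rfl | hn
    · simp
    · simpa using div_le_self (pow_nonneg (abs_nonneg r) n) (Nat.one_le_cast.2 hn)
  have hintegral := intervalIntegral.hasSum_integral_of_dominated_convergence
    (μ := MeasureTheory.volume) (a := 0) (b := π / 4) (fun (n : ℕ) _ => |r| ^ n)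
    (fun n => (by fun_prop :
      Continuous fun u => (-1 : ℝ) ^ (n + 1) * r ^ n / n * cos (2 * n * u)).aestronglyMeasurable)
    (fun n => .of_forall fun u _ => hbound n u)
    (.of_forall fun u _ => summable_geometric_of_lt_one (abs_nonneg r) hr) (by simp)
    (.of_forall fun u _ => hasSum_log_one_add_two_mul_cos hr u)
  refine hintegral.congr_fun fun n => ?_
  rw [intervalIntegral.integral_const_mul, catalanCoeff]
  rcases eq_or_ne n 0 with rfl | hn
  · simp
  · rw [integral_cos_two_mul hn]
    ring

theorem integral_log_one_add_cos_eq :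
    ∫ u in (0 : ℝ)..π / 4, 1 / 2 * log (1 + 2 * |cos (2 * u)| + 1) = catalanC / 2 := by
  let I : ℝ → ℝ := fun r => ∫ u in (0 : ℝ)..π / 4, 1 / 2 * log (1 + 2 * |r * cos (2 * u)| + r ^ 2)
  have hI : Continuous I := by
    refine intervalIntegral.continuous_parametric_intervalIntegral_of_continuous' ?_ _ _
    refine continuous_const.mul (Continuous.log (by fun_prop) fun p => ?_)
    positivity
  have hseries {r : ℝ} (hr : r ∈ Ico 0 1) : ∑' n, catalanCoeff n * r ^ n = I r := by
    rw [(hasSum_integral_log_one_add_two_mul_cos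
      ((abs_of_nonneg hr.1).trans_lt hr.2)).tsum_eq]
    refine intervalIntegral.integral_congr fun u hu => ?_
    rw [uIcc_of_le (by positivity)] at hu
    have hcos : 0 ≤ cos (2 * u) :=
      cos_nonneg_of_mem_Icc ⟨by linarith [hu.1, pi_pos], by linarith [hu.2]⟩
    simp only [abs_of_nonneg (mul_nonneg hr.1 hcos)]
  have habel := Real.tendsto_tsum_powerSeries_nhdsWithin_lt hasSum_catalanCoeff.tendsto_sum_nat
  have hlim : Tendsto I (𝓝[<] 1) (𝓝 (catalanC / 2)) := by
    refine habel.congr' ?_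
    filter_upwards [Ico_mem_nhdsLT (zero_lt_one (α := ℝ))] with r hr
    exact hseries hr
  simpa [I] using tendsto_nhds_unique (hI.tendsto' 1 _ rfl |>.mono_left nhdsWithin_le_nhds) hlim

theorem integral_log_two_mul_cos :
    ∫ u in (0 : ℝ)..π / 4, log (2 * cos u) = catalanC / 2 := by
  rw [← integral_log_one_add_cos_eq]
  refine intervalIntegral.integral_congr fun u hu => ?_
  rw [uIcc_of_le (by positivity)] at hu
  have hcos : 0 ≤ cos (2 * u) :=
    cos_nonneg_of_mem_Icc ⟨by linarith [hu.1, pi_pos], by linarith [hu.2]⟩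
  have hsq : 1 + 2 * |cos (2 * u)| + 1 = (2 * cos u) ^ 2 := by
    rw [abs_of_nonneg hcos, cos_two_mul]
    ring
  simp only [hsq, Real.log_pow]
  push_cast
  ring

theorem catalanC_pos : 0 < catalanC := by
  have hcos {u : ℝ} (hu : u ∈ Icc (0 : ℝ) (π / 4)) : 1 < 2 * cos u := by
    have hle : cos (π / 4) ≤ cos u :=
      cos_le_cos_of_nonneg_of_le_pi hu.1 (by linarith [pi_pos]) hu.2
    have hsqrt : (1 : ℝ) < √2 := by rw [lt_sqrt] <;> norm_num
    rw [cos_pi_div_four] at hle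
    linarith
  have hpos : 0 < ∫ u in (0 : ℝ)..π / 4, log (2 * cos u) := by
    refine intervalIntegral.intervalIntegral_pos_of_pos_on ?_
      (fun u hu => log_pos (hcos (Ioo_subset_Icc_self hu))) (by positivity)
    refine ContinuousOn.intervalIntegrable ?_
    rw [uIcc_of_le (by positivity)]
    exact ContinuousOn.log (by fun_prop) fun u hu => (by linarith [hcos hu])
  rw [integral_log_two_mul_cos] at hpos
  linarith

theorem integral_log_one_add_sin :
    ∫ θ in (0 : ℝ)..π / 2, log ((1 + sin θ) / 2) = 2 * catalanC - π * log 2 := by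
  have hcos {θ : ℝ} (hθ : θ ∈ Icc 0 (π / 2)) : 0 < cos (π / 4 - θ / 2) :=
    cos_pos_of_mem_Ioo ⟨by linarith [hθ.2, pi_pos], by linarith [hθ.1, pi_pos]⟩
  have hhalf {θ : ℝ} (hθ : θ ∈ Icc 0 (π / 2)) : log ((1 + sin θ) / 2) =
      2 * log (2 * cos (π / 4 - θ / 2)) - 2 * log 2 := by
    have hsq : (1 + sin θ) / 2 = cos (π / 4 - θ / 2) ^ 2 := by
      rw [cos_sq, show 2 * (π / 4 - θ / 2) = π / 2 - θ by ring, cos_pi_div_two_sub]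
      ring
    rw [hsq, Real.log_pow, Real.log_mul two_ne_zero (hcos hθ).ne']
    push_cast
    ring
  have hintegrable : IntervalIntegrable (fun u => 2 * log (2 * cos u)) MeasureTheory.volume
      0 (π / 4) := by
    refine (ContinuousOn.intervalIntegrable ?_).const_mul 2
    rw [uIcc_of_le (by positivity)]
    refine ContinuousOn.log (by fun_prop) fun u hu => (mul_pos two_pos ?_).ne'
    exact cos_pos_of_mem_Ioo ⟨by linarith [hu.1, pi_pos], by linarith [hu.2, pi_pos]⟩
  calc ∫ θ in (0 : ℝ)..π / 2, log ((1 + sin θ) / 2)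
      = ∫ θ in (0 : ℝ)..π / 2, (2 * log (2 * cos (π / 4 - θ / 2)) - 2 * log 2) :=
        intervalIntegral.integral_congr fun θ hθ =>
          hhalf (by rwa [uIcc_of_le (by positivity)] at hθ)
    _ = 2 * ∫ u in (0 : ℝ)..π / 4, (2 * log (2 * cos u) - 2 * log 2) := by
        rw [intervalIntegral.integral_comp_sub_div
          (fun u => 2 * log (2 * cos u) - 2 * log 2) two_ne_zero, smul_eq_mul]
        congr 2 <;> ring
    _ = 2 * catalanC - π * log 2 := by
        rw [intervalIntegral.integral_sub hintegrable (by simp),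
          intervalIntegral.integral_const_mul, integral_log_two_mul_cos,
          intervalIntegral.integral_const, smul_eq_mul]
        ring

end CatalanIntegrals

section CosineMoments

open Real Set

/-- The average of `cos ^ k` over a period. -/
noncomputable def cosMoment (k : ℕ) : ℝ := 1 / π * ∫ θ in (0 : ℝ)..π, cos θ ^ k

theorem cosMoment_zero : cosMoment 0 = 1 := by
  simp [cosMoment, pi_ne_zero]

theorem cosMoment_one : cosMoment 1 = 0 := by
  simp [cosMoment]

theorem cosMoment_add_two (k : ℕ) : cosMoment (k + 2) = (k + 1) / (k + 2) * cosMoment k := by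
  simp only [cosMoment, integral_cos_pow, sin_pi, sin_zero, mul_zero, sub_zero, zero_div, zero_add]
  ring

theorem cosMoment_nonneg : ∀ k, 0 ≤ cosMoment k
  | 0 => cosMoment_zero ▸ zero_le_one
  | 1 => cosMoment_one.ge
  | k + 2 => cosMoment_add_two k ▸ mul_nonneg (by positivity) (cosMoment_nonneg k)

theorem cosMoment_sq : ∀ k,
    cosMoment k ^ 2 = cosMoment k * (2 / π * ∫ θ in (0 : ℝ)..π / 2, cos θ ^ k)
  | 0 => by simp [cosMoment_zero]
  | 1 => by simp [cosMoment_one]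
  | k + 2 => by
    rw [cosMoment_add_two, integral_cos_pow, cos_pi_div_two, sin_zero, zero_pow k.succ_ne_zero]
    linear_combination ((k + 1 : ℝ) / (k + 2)) ^ 2 * cosMoment_sq k

theorem add_one_mul_cosMoment_add_one (k : ℕ) :
    (k + 1) * cosMoment (k + 1) = k * cosMoment (k - 1) := by
  cases k with
  | zero => simp [cosMoment_one]
  | succ k =>
    rw [cosMoment_add_two, Nat.add_sub_cancel]
    push_cast
    field_simp
    ring

/-- A truncation of the generating function of the moments, whose sum is `1 / √(1 - x²)`. -/
noncomputable def momentSum (K : ℕ) (x : ℝ) : ℝ := ∑ k ∈ Finset.range (K + 1), cosMoment k * x ^ k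

/-- A truncation of the logarithmic generating function of the moments, whose sum is
`-log ((1 + √(1 - x²)) / 2)`. -/
noncomputable def logMomentSum (K : ℕ) (x : ℝ) : ℝ :=
  ∑ k ∈ Finset.range K, cosMoment (k + 1) * x ^ (k + 1) / (k + 1)

theorem momentSum_eq_one_add (K : ℕ) (x : ℝ) :
    momentSum K x = 1 + x * ∑ k ∈ Finset.range K, cosMoment (k + 1) * x ^ k := by
  rw [momentSum, Finset.sum_range_succ', cosMoment_zero, pow_zero, mul_one, add_comm,
    Finset.mul_sum]
  exact congrArg _ (Finset.sum_congr rfl fun k _ => by ring)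

theorem hasDerivAt_momentSum (K : ℕ) (x : ℝ) : HasDerivAt (momentSum K)
    (∑ k ∈ Finset.range K, cosMoment (k + 1) * ((k + 1) * x ^ k)) x := by
  have hsum : HasDerivAt (momentSum K)
      (∑ k ∈ Finset.range (K + 1), cosMoment k * (k * x ^ (k - 1))) x :=
    HasDerivAt.fun_sum fun k _ => (hasDerivAt_pow k x).const_mul _
  simpa [Finset.sum_range_succ'] using hsum

theorem hasDerivAt_logMomentSum (K : ℕ) (x : ℝ) : HasDerivAt (logMomentSum K)
    (∑ k ∈ Finset.range K, cosMoment (k + 1) * x ^ k) x := by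
  refine HasDerivAt.fun_sum fun k _ => ?_
  have hterm := ((hasDerivAt_pow (k + 1) x).const_mul (cosMoment (k + 1))).div_const ((k : ℝ) + 1)
  refine hterm.congr_deriv ?_
  push_cast
  field_simp

/-- The truncated form of the differential equation `(1 - x²) y' = x y` of `1 / √(1 - x²)`. -/
theorem mul_momentSum_sub (K : ℕ) (x : ℝ) : x * momentSum K x -
    (1 - x ^ 2) * (∑ k ∈ Finset.range K, cosMoment (k + 1) * ((k + 1) * x ^ k)) =
      (K + 1) * cosMoment K * x ^ (K + 1) + K * cosMoment (K - 1) * x ^ K := by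
  induction K with
  | zero => simp [momentSum, cosMoment_zero]
  | succ K ih =>
    have hsucc : momentSum (K + 1) x = momentSum K x + cosMoment (K + 1) * x ^ (K + 1) :=
      Finset.sum_range_succ _ _
    rw [hsucc, Finset.sum_range_succ, Nat.add_sub_cancel]
    push_cast
    linear_combination ih - x ^ K * add_one_mul_cosMoment_add_one K

theorem momentSum_cos_mul_sin_le {θ : ℝ} (hθ : θ ∈ Icc 0 (π / 2)) (K : ℕ) :
    momentSum K (cos θ) * sin θ ≤ 1 := by
  have hderiv (θ : ℝ) : HasDerivAt (fun θ => momentSum K (cos θ) * sin θ)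
      ((∑ k ∈ Finset.range K, cosMoment (k + 1) * ((k + 1) * cos θ ^ k)) * (-sin θ) * sin θ +
        momentSum K (cos θ) * cos θ) θ :=
    ((hasDerivAt_momentSum K (cos θ)).comp θ (hasDerivAt_cos θ)).mul (hasDerivAt_sin θ)
  have hmono : MonotoneOn (fun θ => momentSum K (cos θ) * sin θ) (Icc 0 (π / 2)) := by
    refine monotoneOn_of_deriv_nonneg (convex_Icc _ _)
      (fun θ _ => (hderiv θ).continuousAt.continuousWithinAt)
      (fun θ _ => (hderiv θ).differentiableAt.differentiableWithinAt) fun θ hθ => ?_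
    rw [interior_Icc] at hθ
    have hcos : 0 ≤ cos θ := cos_nonneg_of_mem_Icc ⟨by linarith [hθ.1, pi_pos], hθ.2.le⟩
    have hnonneg : 0 ≤ (K + 1 : ℝ) * cosMoment K * cos θ ^ (K + 1) +
        K * cosMoment (K - 1) * cos θ ^ K := by
      have := cosMoment_nonneg K
      have := cosMoment_nonneg (K - 1)
      positivity
    rw [← mul_momentSum_sub, ← sin_sq] at hnonneg
    rw [(hderiv θ).deriv]
    linarith
  refine (hmono hθ (right_mem_Icc.2 (by positivity)) hθ.2).trans_eq ?_
  simp only [cos_pi_div_two, sin_pi_div_two, momentSum_eq_one_add, zero_mul, add_zero, mul_one]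

theorem one_add_sin_pos {θ : ℝ} (hθ : θ ∈ Icc 0 (π / 2)) : 0 < 1 + sin θ := by
  linarith [sin_nonneg_of_nonneg_of_le_pi hθ.1 (by linarith [hθ.2, pi_pos])]

theorem sum_cosMoment_mul_sin_le {θ : ℝ} (hθ : θ ∈ Ioo 0 (π / 2)) (K : ℕ) :
    (∑ k ∈ Finset.range K, cosMoment (k + 1) * cos θ ^ k) * sin θ ≤ cos θ / (1 + sin θ) := by
  have hθ' := Ioo_subset_Icc_self hθ
  have hcos : 0 < cos θ := cos_pos_of_mem_Ioo ⟨by linarith [hθ.1, pi_pos], hθ.2⟩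
  have hmoment := momentSum_cos_mul_sin_le hθ' K
  rw [momentSum_eq_one_add] at hmoment
  rw [le_div_iff₀ (one_add_sin_pos hθ')]
  refine le_of_mul_le_mul_left ?_ hcos
  calc cos θ * ((∑ k ∈ Finset.range K, cosMoment (k + 1) * cos θ ^ k) * sin θ * (1 + sin θ))
      = (cos θ * (∑ k ∈ Finset.range K, cosMoment (k + 1) * cos θ ^ k) * sin θ) * (1 + sin θ) := by
        ring
    _ ≤ (1 - sin θ) * (1 + sin θ) :=
        mul_le_mul_of_nonneg_right (by linarith) (one_add_sin_pos hθ').le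
    _ = cos θ * cos θ := by linear_combination -sin_sq_add_cos_sq θ

theorem logMomentSum_cos_le {θ : ℝ} (hθ : θ ∈ Icc 0 (π / 2)) (K : ℕ) :
    logMomentSum K (cos θ) ≤ -log ((1 + sin θ) / 2) := by
  have hderiv {θ : ℝ} (hθ : θ ∈ Icc 0 (π / 2)) : HasDerivAt
      (fun θ => logMomentSum K (cos θ) + log ((1 + sin θ) / 2))
      ((∑ k ∈ Finset.range K, cosMoment (k + 1) * cos θ ^ k) * (-sin θ) +
        cos θ / 2 / ((1 + sin θ) / 2)) θ :=
    ((hasDerivAt_logMomentSum K (cos θ)).comp θ (hasDerivAt_cos θ)).add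
      ((((hasDerivAt_sin θ).const_add 1).div_const 2).log (by linarith [one_add_sin_pos hθ]))
  have hmono : MonotoneOn (fun θ => logMomentSum K (cos θ) + log ((1 + sin θ) / 2))
      (Icc 0 (π / 2)) := by
    refine monotoneOn_of_deriv_nonneg (convex_Icc _ _)
      (fun θ hθ => (hderiv hθ).continuousAt.continuousWithinAt)
      (fun θ hθ => (hderiv (interior_subset hθ)).differentiableAt.differentiableWithinAt)
      fun θ hθ => ?_
    rw [(hderiv (interior_subset hθ)).deriv, div_div_div_cancel_right₀ two_ne_zero]
    rw [interior_Icc] at hθ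
    linarith [sum_cosMoment_mul_sin_le hθ K]
  have hle := hmono hθ (right_mem_Icc.2 (by positivity)) hθ.2
  have hzero : logMomentSum K 0 = 0 := by simp [logMomentSum]
  simp only [cos_pi_div_two, sin_pi_div_two, hzero, one_add_one_eq_two,
    div_self (two_ne_zero (α := ℝ)), log_one, add_zero] at hle
  linarith

theorem sum_cosMoment_sq_div_eq_integral (K : ℕ) :
    ∑ k ∈ Finset.range K, cosMoment (k + 1) ^ 2 / (k + 1) =
      2 / π * ∫ θ in (0 : ℝ)..π / 2, logMomentSum K (cos θ) := by
  simp only [logMomentSum]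
  rw [intervalIntegral.integral_finsetSum fun k _ =>
    Continuous.intervalIntegrable (by fun_prop) _ _, Finset.mul_sum]
  refine Finset.sum_congr rfl fun k _ => ?_
  rw [intervalIntegral.integral_div, intervalIntegral.integral_const_mul, cosMoment_sq]
  ring

theorem sum_cosMoment_sq_div_le (K : ℕ) :
    ∑ k ∈ Finset.range K, cosMoment (k + 1) ^ 2 / (k + 1) ≤ log 4 - 4 * catalanC / π := by
  have hle : ∫ θ in (0 : ℝ)..π / 2, logMomentSum K (cos θ) ≤
      ∫ θ in (0 : ℝ)..π / 2, -log ((1 + sin θ) / 2) := by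
    refine intervalIntegral.integral_mono_on (by positivity) ?_ ?_
      fun θ hθ => logMomentSum_cos_le hθ K
    · refine Continuous.intervalIntegrable ?_ _ _
      simp only [logMomentSum]
      fun_prop
    · refine ContinuousOn.intervalIntegrable ?_
      rw [uIcc_of_le (by positivity)]
      exact (ContinuousOn.log (by fun_prop) fun θ hθ =>
        (half_pos (one_add_sin_pos hθ)).ne').neg
  rw [intervalIntegral.integral_neg, integral_log_one_add_sin] at hle
  calc ∑ k ∈ Finset.range K, cosMoment (k + 1) ^ 2 / (k + 1)
      ≤ 2 / π * -(2 * catalanC - π * log 2) := by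
        rw [sum_cosMoment_sq_div_eq_integral]
        gcongr
    _ = log 4 - 4 * catalanC / π := by
        have := pi_ne_zero
        rw [show (4 : ℝ) = 2 ^ 2 by norm_num, Real.log_pow]
        push_cast
        field_simp
        ring

end CosineMoments

section Spectrum

open Finset Matrix

variable {V : Type*} [Fintype V]

theorem abs_lt_of_adjMatrix_mulVec_eq {H : SimpleGraph V} [DecidableRel H.Adj] {d : ℕ}
    (hdeg : ∀ v, H.degree v ≤ d)
    (hsub : ∀ S : Finset V, S.Nonempty → ∃ v ∈ S, #{u ∈ S | H.Adj v u} < d)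
    {μ : ℝ} {x : V → ℝ} (hx : x ≠ 0) (hμ : H.adjMatrix ℝ *ᵥ x = μ • x) : |μ| < d := by
  obtain ⟨u₀, hu₀⟩ := Function.ne_iff.1 hx
  obtain ⟨m, -, hm⟩ := univ.exists_max_image (fun u => |x u|) ⟨u₀, mem_univ _⟩
  obtain ⟨v, hv, hlow⟩ := hsub {u | |x u| = |x m|} ⟨m, by simp⟩
  have hmax (u : V) : |x u| ≤ |x v| := (hm u (mem_univ _)).trans_eq (mem_filter.1 hv).2.symm
  have hpos : 0 < |x v| := (abs_pos.2 hu₀).trans_le (hmax u₀)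
  have hμv : |μ| * |x v| ≤ ∑ u ∈ H.neighborFinset v, |x u| := by
    rw [← abs_mul, ← smul_eq_mul, ← Pi.smul_apply, ← hμ, SimpleGraph.adjMatrix_mulVec_apply]
    exact abs_sum_le_sum_abs _ _
  refine lt_of_mul_lt_mul_right (hμv.trans_lt ?_) hpos.le
  by_cases hall : ∀ u ∈ H.neighborFinset v, |x u| = |x v|
  · have hlt : H.degree v < d := by
      refine lt_of_le_of_lt (card_le_card fun u hu => ?_) hlow
      rw [mem_filter, mem_filter, ← SimpleGraph.mem_neighborFinset, hall u hu]
      exact ⟨⟨mem_univ _, (mem_filter.1 hv).2⟩, hu⟩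
    rw [sum_congr rfl hall, sum_const, nsmul_eq_mul]
    exact mul_lt_mul_of_pos_right (Nat.cast_lt.2 hlt) hpos
  · push Not at hall
    obtain ⟨u, hu, hne⟩ := hall
    calc ∑ u ∈ H.neighborFinset v, |x u| < ∑ _u ∈ H.neighborFinset v, |x v| :=
          sum_lt_sum (fun u _ => hmax u) ⟨u, hu, (hmax u).lt_of_ne hne⟩
      _ = H.degree v * |x v| := by rw [sum_const, nsmul_eq_mul, SimpleGraph.degree]
      _ ≤ d * |x v| := mul_le_mul_of_nonneg_right (Nat.cast_le.2 (hdeg v)) hpos.le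

variable [DecidableEq V] {A : Matrix V V ℝ} {d : ℝ}

theorem trace_pow_eq_sum_eigenvalues_pow (hA : A.IsHermitian) (k : ℕ) :
    (A ^ k).trace = ∑ i, hA.eigenvalues i ^ k := by
  conv_lhs => rw [hA.spectral_theorem, ← map_pow, diagonal_pow,
    Unitary.conjStarAlgAut_apply, trace_mul_cycle]
  simp [Matrix.trace]

theorem det_smul_one_sub_eq_prod (hA : A.IsHermitian) (d : ℝ) :
    (d • 1 - A).det = ∏ i, (d - hA.eigenvalues i) := by
  have hchar := eval_charpoly A d
  rw [hA.charpoly_eq, Polynomial.eval_prod] at hchar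
  simp only [Polynomial.eval_sub, Polynomial.eval_X, Polynomial.eval_C] at hchar
  rw [smul_one_eq_diagonal]
  exact hchar.symm

theorem det_smul_one_sub_pos (hA : A.IsHermitian) (hd : ∀ i, |hA.eigenvalues i| < d) :
    0 < (d • 1 - A).det := by
  rw [det_smul_one_sub_eq_prod hA]
  exact prod_pos fun i _ => sub_pos.2 ((le_abs_self _).trans_lt (hd i))

theorem hasSum_trace_pow_div (hA : A.IsHermitian) (h0 : 0 < d)
    (hd : ∀ i, |hA.eigenvalues i| < d) :
    HasSum (fun k : ℕ => (A ^ (k + 1)).trace / d ^ (k + 1) / (k + 1))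
      (Fintype.card V * Real.log d - Real.log (d • 1 - A).det) := by
  have hpos (i : V) : 0 < d - hA.eigenvalues i := sub_pos.2 ((le_abs_self _).trans_lt (hd i))
  have hlog (i : V) : -Real.log (1 - hA.eigenvalues i / d) =
      Real.log d - Real.log (d - hA.eigenvalues i) := by
    rw [one_sub_div h0.ne', Real.log_div (hpos i).ne' h0.ne', neg_sub]
  have hsum : HasSum (fun k : ℕ => ∑ i, (hA.eigenvalues i / d) ^ (k + 1) / ((k : ℝ) + 1))
      (∑ i, -Real.log (1 - hA.eigenvalues i / d)) := by
    refine hasSum_sum fun i _ => Real.hasSum_pow_div_log_of_abs_lt_one ?_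
    rw [abs_div, abs_of_pos h0, div_lt_one h0]
    exact hd i
  simp only [div_pow, ← sum_div, ← trace_pow_eq_sum_eigenvalues_pow, hlog, sum_sub_distrib,
    sum_const, card_univ, nsmul_eq_mul] at hsum
  rwa [det_smul_one_sub_eq_prod hA, Real.log_prod fun i _ => (hpos i).ne']

end Spectrum

section LatticeWalks

open Real

/-- The number of `k`-step nearest-neighbour walks from `0` to `j` on `ℤ`, as a Fourier integral. -/
noncomputable def lineWalkCount (k : ℕ) (j : ℤ) : ℝ :=
  1 / π * ∫ θ in (0 : ℝ)..π, (2 * cos θ) ^ k * cos (j * θ)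

theorem lineWalkCount_zero (j : ℤ) : lineWalkCount 0 j = if j = 0 then 1 else 0 := by
  split_ifs with hj
  · simp [lineWalkCount, hj, pi_ne_zero]
  · simp only [lineWalkCount, pow_zero, one_mul]
    rw [intervalIntegral.integral_comp_mul_left (fun x => cos x) (Int.cast_ne_zero.2 hj),
      integral_cos]
    simp [sin_int_mul_pi]

theorem lineWalkCount_succ (k : ℕ) (j : ℤ) :
    lineWalkCount (k + 1) j = lineWalkCount k (j - 1) + lineWalkCount k (j + 1) := by
  simp only [lineWalkCount]
  rw [← mul_add, ← intervalIntegral.integral_add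
    (Continuous.intervalIntegrable (by fun_prop) _ _)
    (Continuous.intervalIntegrable (by fun_prop) _ _)]
  congr 1
  refine intervalIntegral.integral_congr fun θ _ => ?_
  have hcos : cos ((j - 1 : ℤ) * θ) + cos ((j + 1 : ℤ) * θ) = 2 * cos θ * cos (j * θ) := by
    push_cast
    rw [sub_mul, add_mul, one_mul, cos_sub, cos_add]
    ring
  simp only [← mul_add, hcos]
  ring

theorem lineWalkCount_nonneg (k : ℕ) (j : ℤ) : 0 ≤ lineWalkCount k j := by
  induction k generalizing j with
  | zero =>
    rw [lineWalkCount_zero]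
    positivity
  | succ k ih =>
    rw [lineWalkCount_succ]
    exact add_nonneg (ih _) (ih _)

theorem lineWalkCount_self (k : ℕ) : lineWalkCount k 0 = 2 ^ k * cosMoment k := by
  simp only [lineWalkCount, cosMoment, Int.cast_zero, zero_mul, cos_zero, mul_one, mul_pow,
    intervalIntegral.integral_const_mul]
  ring

/-- The number of `k`-step walks from `p` to `q` on the square lattice, which splits into a product
because the two diagonal coordinates of a lattice walk perform independent walks on `ℤ`. -/
noncomputable def latticeWalkCount (k : ℕ) (p q : ℤ × ℤ) : ℝ :=
  lineWalkCount k (q.1 - p.1 + (q.2 - p.2)) * lineWalkCount k (q.1 - p.1 - (q.2 - p.2))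

theorem latticeWalkCount_nonneg (k : ℕ) (p q : ℤ × ℤ) : 0 ≤ latticeWalkCount k p q :=
  mul_nonneg (lineWalkCount_nonneg _ _) (lineWalkCount_nonneg _ _)

theorem latticeWalkCount_self (k : ℕ) (p : ℤ × ℤ) :
    latticeWalkCount k p p = 4 ^ k * cosMoment k ^ 2 := by
  simp only [latticeWalkCount, sub_self, add_zero, lineWalkCount_self]
  rw [show (4 : ℝ) = 2 * 2 by norm_num, mul_pow]
  ring

theorem sum_latticeNeighbors_latticeWalkCount (k : ℕ) (p q : ℤ × ℤ) :
    ∑ r ∈ latticeNeighbors q, latticeWalkCount k p r = latticeWalkCount (k + 1) p q := by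
  obtain ⟨a, b⟩ := p
  obtain ⟨c, d⟩ := q
  simp only [sum_latticeNeighbors, latticeWalkCount, lineWalkCount_succ]
  rw [show c + 1 - a + (d - b) = c - a + (d - b) + 1 by ring,
    show c + 1 - a - (d - b) = c - a - (d - b) + 1 by ring,
    show c - 1 - a + (d - b) = c - a + (d - b) - 1 by ring,
    show c - 1 - a - (d - b) = c - a - (d - b) - 1 by ring,
    show c - a + (d + 1 - b) = c - a + (d - b) + 1 by ring,
    show c - a - (d + 1 - b) = c - a - (d - b) - 1 by ring,
    show c - a + (d - 1 - b) = c - a + (d - b) - 1 by ring,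
    show c - a - (d - 1 - b) = c - a - (d - b) + 1 by ring]
  ring

end LatticeWalks

section LatticeSpectrum

open Finset Matrix

variable {D : Set (ℤ × ℤ)} [DecidableRel (squareLattice.induce D).Adj]

theorem isHermitian_adjMatrix_induce : ((squareLattice.induce D).adjMatrix ℝ).IsHermitian :=
  isHermitian_iff_isSymm.2 (SimpleGraph.isSymm_adjMatrix _)

theorem exists_card_filter_adj_lt_four {S : Finset D} (hS : S.Nonempty) :
    ∃ p ∈ S, #{q ∈ S | (squareLattice.induce D).Adj p q} < 4 := by
  obtain ⟨p, hp, htop⟩ := S.exists_max_image (fun q => q.1.2) hS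
  refine ⟨p, hp, Nat.lt_succ_of_le ?_⟩
  have hsub : ({q ∈ S | (squareLattice.induce D).Adj p q}).map (.subtype _) ⊆
      {(p.1.1 + 1, p.1.2), (p.1.1 - 1, p.1.2), (p.1.1, p.1.2 - 1)} := by
    intro q hq
    obtain ⟨r, hr, rfl⟩ := mem_map.1 hq
    obtain ⟨hrS, hadj⟩ := mem_filter.1 hr
    have hle := htop r hrS
    have hcases := (squareLattice_adj_iff p r).1 hadj
    simp only [Function.Embedding.subtype_apply, mem_insert, mem_singleton,
      Prod.ext_iff] at hcases ⊢
    omega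
  rw [← card_map (.subtype _)]
  exact (card_le_card hsub).trans card_le_three

variable [Fintype D]

theorem map_neighborFinset_subset_latticeNeighbors (p : D) :
    ((squareLattice.induce D).neighborFinset p).map (.subtype _) ⊆ latticeNeighbors p := by
  intro q hq
  obtain ⟨r, hr, rfl⟩ := mem_map.1 hq
  exact mem_latticeNeighbors.2 ((SimpleGraph.mem_neighborFinset (squareLattice.induce D) p r).1 hr)

theorem degree_induce_squareLattice_le (p : D) : (squareLattice.induce D).degree p ≤ 4 := by
  rw [← SimpleGraph.card_neighborFinset_eq_degree, ← card_map (.subtype _)]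
  exact (card_le_card (map_neighborFinset_subset_latticeNeighbors p)).trans card_le_four

variable [DecidableEq D]

theorem abs_eigenvalues_lt_four (p : D) :
    |(isHermitian_adjMatrix_induce (D := D)).eigenvalues p| < 4 := by
  have hA := isHermitian_adjMatrix_induce (D := D)
  refine abs_lt_of_adjMatrix_mulVec_eq (d := 4) degree_induce_squareLattice_le
    (fun S hS => exists_card_filter_adj_lt_four hS) ?_ (hA.mulVec_eigenvectorBasis p)
  exact fun h => hA.eigenvectorBasis.orthonormal.ne_zero p (by ext q; exact congrFun h q)

theorem adjMatrix_pow_le_latticeWalkCount (k : ℕ) (p q : D) :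
    ((squareLattice.induce D).adjMatrix ℝ ^ k) p q ≤ latticeWalkCount k p q := by
  induction k generalizing q with
  | zero =>
    rw [pow_zero, one_apply]
    split_ifs with h
    · rw [h, latticeWalkCount_self, cosMoment_zero, pow_zero, one_pow, mul_one]
    · exact latticeWalkCount_nonneg _ _ _
  | succ k ih =>
    rw [pow_succ, SimpleGraph.mul_adjMatrix_apply, ← sum_latticeNeighbors_latticeWalkCount]
    refine (sum_le_sum fun r _ => ih r).trans ?_
    refine (sum_map _ (.subtype _) (latticeWalkCount k p)).symm.trans_le ?_
    exact sum_le_sum_of_subset_of_nonneg (map_neighborFinset_subset_latticeNeighbors q)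
      fun r _ _ => latticeWalkCount_nonneg _ _ _

theorem trace_adjMatrix_pow_le (k : ℕ) : ((squareLattice.induce D).adjMatrix ℝ ^ k).trace ≤
    Fintype.card D * (4 ^ k * cosMoment k ^ 2) := by
  rw [← nsmul_eq_mul, ← card_univ]
  exact sum_le_card_nsmul _ _ _ fun p _ =>
    (adjMatrix_pow_le_latticeWalkCount k p p).trans_eq (latticeWalkCount_self k p)

theorem trace_adjMatrix_pow_nonneg (k : ℕ) :
    0 ≤ ((squareLattice.induce D).adjMatrix ℝ ^ k).trace := by
  refine sum_nonneg fun p _ => ?_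
  rw [diag_apply, SimpleGraph.adjMatrix_pow_apply_eq_card_walk]
  exact Nat.cast_nonneg _

theorem det_four_sub_adjMatrix_pos :
    0 < ((4 : ℝ) • 1 - (squareLattice.induce D).adjMatrix ℝ).det :=
  det_smul_one_sub_pos isHermitian_adjMatrix_induce abs_eigenvalues_lt_four

theorem log_det_four_sub_adjMatrix_le :
    Real.log ((4 : ℝ) • 1 - (squareLattice.induce D).adjMatrix ℝ).det ≤
      Fintype.card D * Real.log 4 := by
  have hsum := hasSum_trace_pow_div isHermitian_adjMatrix_induce four_pos
    (abs_eigenvalues_lt_four (D := D))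
  refine sub_nonneg.1 (hsum.nonneg fun k => ?_)
  have := trace_adjMatrix_pow_nonneg (D := D) (k + 1)
  positivity

theorem le_log_det_four_sub_adjMatrix :
    Fintype.card D * (4 * catalanC / Real.pi) ≤
      Real.log ((4 : ℝ) • 1 - (squareLattice.induce D).adjMatrix ℝ).det := by
  have hsum := hasSum_trace_pow_div isHermitian_adjMatrix_induce four_pos
    (abs_eigenvalues_lt_four (D := D))
  have hterm (k : ℕ) :
      ((squareLattice.induce D).adjMatrix ℝ ^ (k + 1)).trace / 4 ^ (k + 1) / (k + 1) ≤
        Fintype.card D * (cosMoment (k + 1) ^ 2 / (k + 1)) := by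
    rw [← mul_div_assoc]
    gcongr
    rw [div_le_iff₀ (by positivity)]
    exact (trace_adjMatrix_pow_le (k + 1)).trans_eq (by ring)
  have hle := le_of_tendsto' hsum.tendsto_sum_nat fun K =>
    calc ∑ k ∈ range K,
          ((squareLattice.induce D).adjMatrix ℝ ^ (k + 1)).trace / 4 ^ (k + 1) / ((k : ℝ) + 1)
        ≤ Fintype.card D * ∑ k ∈ range K, cosMoment (k + 1) ^ 2 / ((k : ℝ) + 1) := by
          rw [mul_sum]
          exact sum_le_sum fun k _ => hterm k
      _ ≤ Fintype.card D * (Real.log 4 - 4 * catalanC / Real.pi) :=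
          mul_le_mul_of_nonneg_left (sum_cosMoment_sq_div_le K) (Nat.cast_nonneg _)
  linarith

end LatticeSpectrum

section DistrictCounts

open Set

variable {G : squareLattice.Subgraph}

theorem IsSimplyConnectedGrid.log_numSpanningTrees_bounds (hG : IsSimplyConnectedGrid G) :
    0 < numSpanningTrees G ∧
      gridArea G * Real.log bulkBase ≤ Real.log (numSpanningTrees G) ∧
      Real.log (numSpanningTrees G) ≤ gridArea G * Real.log 4 := by
  classical
  have := (finite_gridFaces hG.finite_verts).fintype
  have hcard : (gridArea G : ℝ) = Fintype.card (gridFaces G) := by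
    rw [gridArea, ← Nat.card_coe_set_eq, Nat.card_eq_fintype_card]
  rw [← Nat.cast_pos (α := ℝ), hG.numSpanningTrees_eq_det, hcard, bulkBase, Real.log_exp]
  exact ⟨det_four_sub_adjMatrix_pos, le_log_det_four_sub_adjMatrix, log_det_four_sub_adjMatrix_le⟩

variable {K : ℕ} {V : Fin K → Set (ℤ × ℤ)}

theorem image_orientedEdges_diff_eq_cutEdges (hdisj : ∀ i j, i ≠ j → Disjoint (V i) (V j))
    (hcover : ⋃ i, V i = G.verts) :
    (fun e : LatticeEdge => s(e.1, edgeHead e)) ''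
      (orientedEdges G \ ⋃ i, orientedEdges (G.induce (V i))) = cutEdges G V := by
  have not_mem_of_ne {i j : Fin K} (hij : i ≠ j) {e : LatticeEdge} (hi : e.1 ∈ V i)
      (hj : edgeHead e ∈ V j) : e ∉ ⋃ i, orientedEdges (G.induce (V i)) := by
    intro he
    obtain ⟨k, hk⟩ := mem_iUnion.1 he
    have hki : k = i := by_contra fun hne => disjoint_left.1 (hdisj k i hne) hk.1 hi
    have hkj : k = j := by_contra fun hne => disjoint_left.1 (hdisj k j hne) hk.2.1 hj
    exact hij (hki.symm.trans hkj)
  ext s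
  constructor
  · rintro ⟨e, ⟨he, hinner⟩, rfl⟩
    obtain ⟨i, hi⟩ := mem_iUnion.1 (hcover.symm ▸ G.edge_vert he)
    obtain ⟨j, hj⟩ := mem_iUnion.1 (hcover.symm ▸ SimpleGraph.Subgraph.Adj.snd_mem he)
    refine ⟨he, i, j, ?_, _, hi, _, hj, rfl⟩
    rintro rfl
    exact hinner (mem_iUnion.2 ⟨i, hi, hj, he⟩)
  · rintro ⟨he, i, j, hij, p, hp, q, hq, rfl⟩
    obtain ⟨e, ⟨rfl, rfl⟩ | ⟨rfl, rfl⟩⟩ := exists_latticeEdge_of_adj (G.edgeSet_subset he)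
    · exact ⟨e, ⟨he, not_mem_of_ne hij hp hq⟩, rfl⟩
    · exact ⟨e, ⟨SimpleGraph.Subgraph.Adj.symm he, not_mem_of_ne hij.symm hq hp⟩, Sym2.eq_swap⟩

theorem ncard_iUnion_of_disjoint {X ι : Type*} [Fintype ι] {S : ι → Set X}
    (hfin : ∀ i, (S i).Finite) (hS : ∀ i j, i ≠ j → Disjoint (S i) (S j)) :
    (⋃ i, S i).ncard = ∑ i, (S i).ncard := by
  rw [ncard_iUnion_of_finite hfin fun i j => hS i j, finsum_eq_sum_of_fintype]

theorem ncard_cutEdges_add_sum (hfin : G.verts.Finite)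
    (hdisj : ∀ i j, i ≠ j → Disjoint (V i) (V j)) (hcover : ⋃ i, V i = G.verts) :
    (cutEdges G V).ncard + ∑ i, (orientedEdges (G.induce (V i))).ncard =
      (orientedEdges G).ncard := by
  have hE := finite_orientedEdges hfin
  have hsub : ⋃ i, orientedEdges (G.induce (V i)) ⊆ orientedEdges G :=
    iUnion_subset fun i e he => he.2.2
  have hsum := ncard_iUnion_of_disjoint
    (fun i => hE.subset ((subset_iUnion _ i).trans hsub)) fun i j hij =>
      disjoint_left.2 fun e (hi : e ∈ orientedEdges (G.induce (V i))) hj =>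
        disjoint_left.1 (hdisj i j hij) hi.1 hj.1
  rw [← image_orientedEdges_diff_eq_cutEdges hdisj hcover,
    ncard_image_of_injective _ injective_mk_edgeHead, ← hsum]
  exact ncard_sdiff_add_ncard_of_subset hsub hE

theorem ncard_cutEdges_add_sum_gridArea (hG : IsSimplyConnectedGrid G)
    (hdisj : ∀ i j, i ≠ j → Disjoint (V i) (V j)) (hcover : ⋃ i, V i = G.verts)
    (hdistrict : ∀ i, IsSimplyConnectedGrid (G.induce (V i))) :
    (cutEdges G V).ncard + ∑ i, gridArea (G.induce (V i)) + 1 = gridArea G + K := by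
  have hverts : ∑ i, (V i).ncard = G.verts.ncard := by
    rw [← hcover]
    exact (ncard_iUnion_of_disjoint (fun i => (hdistrict i).finite_verts) hdisj).symm
  have heuler := Finset.sum_congr rfl fun i (_ : i ∈ Finset.univ) =>
    (hdistrict i).gridArea_add_ncard_verts
  simp only [SimpleGraph.Subgraph.induce_verts, Finset.sum_add_distrib, Finset.sum_const,
    Finset.card_univ, Fintype.card_fin, smul_eq_mul, mul_one] at heuler
  have hedges := ncard_cutEdges_add_sum hG.finite_verts hdisj hcover
  have hGeuler := hG.gridArea_add_ncard_verts
  omega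

end DistrictCounts

theorem log_bulkBase_pos : 0 < Real.log bulkBase := by
  rw [bulkBase, Real.log_exp]
  have := catalanC_pos
  positivity

theorem proposition7p1_general (G : squareLattice.Subgraph) (hG : IsSimplyConnectedGrid G)
    (K : ℕ) (V : Fin K → Set (ℤ × ℤ))
    (hdisj : ∀ i j : Fin K, i ≠ j → Disjoint (V i) (V j))
    (hcover : (⋃ i, V i) = G.verts)
    (hdistrict : ∀ i, IsSimplyConnectedGrid (G.induce (V i))) :
    ((cutEdges G V).ncard : ℤ) =
        (gridArea G : ℤ) + (K : ℤ) - 1 - ∑ i, (gridArea (G.induce (V i)) : ℤ) ∧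
      ((gridArea G : ℝ) + (K : ℝ) - 1)
          - 1 / Real.log bulkBase * Real.log (∏ i, (numSpanningTrees (G.induce (V i)) : ℝ))
        ≤ ((cutEdges G V).ncard : ℝ) ∧
      ((cutEdges G V).ncard : ℝ) ≤
        ((gridArea G : ℝ) + (K : ℝ) - 1)
          - 1 / Real.log 4 * Real.log (∏ i, (numSpanningTrees (G.induce (V i)) : ℝ)) := by
  have hcount := ncard_cutEdges_add_sum_gridArea hG hdisj hcover hdistrict
  have hcut : ((cutEdges G V).ncard : ℝ) =
      (gridArea G : ℝ) + (K : ℝ) - 1 - ∑ i, (gridArea (G.induce (V i)) : ℝ) := by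
    have := congrArg (Nat.cast : ℕ → ℝ) hcount
    push_cast at this
    linarith
  have hbounds i := (hdistrict i).log_numSpanningTrees_bounds
  rw [Real.log_prod fun i _ => (Nat.cast_pos.2 (hbounds i).1).ne', hcut, one_div, one_div,
    inv_mul_eq_div, inv_mul_eq_div]
  refine ⟨by rw [← Nat.cast_sum]; omega, sub_le_sub_left ?_ _, sub_le_sub_left ?_ _⟩
  · rw [le_div_iff₀ log_bulkBase_pos, Finset.sum_mul]
    exact Finset.sum_le_sum fun i _ => (hbounds i).2.1
  · rw [div_le_iff₀ (Real.log_pos (by norm_num)), Finset.sum_mul]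
    exact Finset.sum_le_sum fun i _ => (hbounds i).2.2

theorem proposition7p1 (G : squareLattice.Subgraph) (hG : IsSimpleGridGraph G)
    (K : ℕ) (V : Fin K → Set (ℤ × ℤ))
    (hdisj : ∀ i j : Fin K, i ≠ j → Disjoint (V i) (V j))
    (hcover : (⋃ i, V i) = G.verts)
    (hdistrict : ∀ i, IsSimpleGridGraph (G.induce (V i))) :
    ((cutEdges G V).ncard : ℤ) =
        (gridArea G : ℤ) + (K : ℤ) - 1 - ∑ i, (gridArea (G.induce (V i)) : ℤ) ∧
      ((gridArea G : ℝ) + (K : ℝ) - 1)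
          - 1 / Real.log bulkBase * Real.log (∏ i, (numSpanningTrees (G.induce (V i)) : ℝ))
        ≤ ((cutEdges G V).ncard : ℝ) ∧
      ((cutEdges G V).ncard : ℝ) ≤
        ((gridArea G : ℝ) + (K : ℝ) - 1)
          - 1 / Real.log 4 * Real.log (∏ i, (numSpanningTrees (G.induce (V i)) : ℝ)) := by
  exact proposition7p1_general G hG.isSimplyConnectedGrid K V hdisj hcover fun i =>
    (hdistrict i).isSimplyConnectedGrid
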